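/- **Swap Bribery-Kemeny Score is solvable in polynomial time.** Let $C$ be a finite set of $m$ candidates. A *ranking* is a linear order of $C$; $x\prec_\pi y$ means that $x$ is before $y$ in the ranking $\pi$. The *Kendall tau distance* of two rankings is $$\mathrm{KT}(\pi,\pi')=\bigl|\{\{x,y\}\subseteq C : (x\prec_\pi y\wedge y\prec_{\pi'}x)\vee(y\prec_\pi x\wedge x\prec_{\pi'}y)\}\bigr|.$$ An *admissible swap* in a ranking exchanges two candidates that are consecutive in it. The problem *Swap Bribery-Kemeny Score* is the following. The input consists of the candidates, a tuple $\mathcal R=(R_1,\dots,R_n)$ of rankings over $C$, a ranking $X$ over $C$, a cost $\mathrm{cost}(R_i)\in\mathbb N$ of one swap in $R_i$ for each $i$, a budget $\mathrm{bgt}\in\mathbb N$, and an integer $k$. The question is whether there are numbers $l_1,\dots,l_n\in\mathbb N$ and rankings $R'_1,\dots,R'_n$ such that $R'_i$ is obtained from $R_i$ by a sequence of exactly $l_i$ admissible swaps (each applied to the result of the previous one), $\sum_{i=1}^n l_i\cdot\mathrm{cost}(R_i)\le \mathrm{bgt}$, and $\sum_{i=1}^n \mathrm{KT}(X,R'_i)\le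 k$. **Theorem.** There are a deterministic multi-stack Turing machine and a polynomial $p$ such that, for every instance of Swap Bribery-Kemeny Score, the machine started on the encoding of the instance halts after at most $p(N)$ steps with the correct yes/no answer as output, where $N$ is the length of the encoding. Here the candidates are $0,\dots,m-1$, each ranking is written as the list of its candidates from top to bottom, and all numbers (candidates, costs, budget, $k$) are written in binary. -/

import Mathlib

namespace SwapBribery

/-- A ranking over the candidates `0, …, m - 1`: the bijection that sends a position
(position `0` is the top) to the candidate ranked there. -/
abbrev Ranking (m : ℕ) : Type := Fin m ≃ Fin m

namespace Ranking

variable {m : ℕ}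

/-- The position of the candidate `c` in the ranking `π`. -/
def pos (π : Ranking m) (c : Fin m) : Fin m := π.symm c

/-- `x ≺_π y`: the candidate `x` is before the candidate `y` in `π`. -/
def Before (π : Ranking m) (x y : Fin m) : Prop := pos π x < pos π y

/-- The unordered pairs of candidates whose relative order differs in `π` and `π'`. -/
def disagreements (π π' : Ranking m) : Set (Finset (Fin m)) :=
  {p | ∃ x y : Fin m, p = {x, y} ∧
    ((Before π x y ∧ Before π' y x) ∨ (Before π y x ∧ Before π' x y))}

/-- The Kendall tau distance of two rankings. -/
noncomputable def kendallTau (π π' : Ranking m) : ℕ := (disagreements π π').ncard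

/-- `S` arises from `R` by one admissible swap: two candidates `c`, `c'` that are consecutive
in `R` exchange their places. -/
def AdmissibleSwap (R S : Ranking m) : Prop :=
  ∃ c c' : Fin m, (pos R c' : ℕ) = (pos R c : ℕ) + 1 ∧ S = R.trans (Equiv.swap c c')

/-- `SwapsTo l R S`: a sequence of exactly `l` admissible swaps, each applied to the result of
the previous one, turns `R` into `S`. -/
inductive SwapsTo : ℕ → Ranking m → Ranking m → Prop
  | refl (R : Ranking m) : SwapsTo 0 R R
  | step {l : ℕ} {R S T : Ranking m} :
      SwapsTo l R S → AdmissibleSwap S T → SwapsTo (l + 1) R T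

end Ranking

/-- An instance of Swap Bribery-Kemeny Score. -/
structure Instance where
  /-- the number of candidates -/
  m : ℕ
  /-- the number of rankings in the profile -/
  n : ℕ
  /-- the profile of rankings, as a tuple -/
  R : Fin n → Ranking m
  /-- the target ranking -/
  X : Ranking m
  /-- `cost i` is the cost of each single swap in the `i`-th ranking -/
  cost : Fin n → ℕ
  /-- the budget -/
  bgt : ℕ
  /-- the bound on the total distance -/
  k : ℤ

/-- The yes-instances: there are a profile `R'` and numbers of swaps `l` such that each `R' i`
arises from `R i` by `l i` admissible swaps, the total cost of these swaps is within the budget,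
and the total Kendall tau distance of `X` from `R'` is at most `k`. -/
def Instance.IsYes (I : Instance) : Prop :=
  ∃ (R' : Fin I.n → Ranking I.m) (l : Fin I.n → ℕ),
    (∀ i, Ranking.SwapsTo (l i) (I.R i) (R' i)) ∧
    ∑ i, l i * I.cost i ≤ I.bgt ∧
    ((∑ i, Ranking.kendallTau I.X (R' i) : ℕ) : ℤ) ≤ I.k

/-! The input string of an instance: all numbers are written in binary, each followed by a comma,
and each ranking is the sequence of its candidates from top to bottom, followed by a semicolon. -/

/-- The input alphabet: the binary digits and two punctuation marks. -/
inductive Letter : Type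
  | bit (b : Bool) : Letter
  | comma : Letter
  | semicolon : Letter
  deriving DecidableEq, Fintype

/-- A natural number in binary (least significant digit first), followed by a comma. -/
def encodeNumber (a : ℕ) : List Letter :=
  (Computability.encodeNat a).map Letter.bit ++ [Letter.comma]

/-- An integer: a sign bit followed by the absolute value. -/
def encodeInteger (a : ℤ) : List Letter :=
  Letter.bit (decide (a < 0)) :: encodeNumber a.natAbs

/-- The candidates of a ranking from top to bottom, followed by a semicolon. -/
def encodeRanking {m : ℕ} (π : Ranking m) : List Letter :=
  (List.finRange m).flatMap (fun i => encodeNumber (π i : ℕ)) ++ [Letter.semicolon]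

/-- The input string: budget, bound `k`, target ranking, and then, for each ranking of the
profile, its swap cost and the ranking itself. -/
def encodeInstance (I : Instance) : List Letter :=
  encodeNumber I.bgt ++ encodeInteger I.k ++ encodeRanking I.X ++
    (List.finRange I.n).flatMap (fun i => encodeNumber (I.cost i) ++ encodeRanking (I.R i))

/-- The answer to an instance. -/
noncomputable def answer (I : Instance) : Bool :=
  @decide I.IsYes (Classical.propDecidable _)

end SwapBribery

/-! Write d_i for the distance of `X` from R_i. An admissible swap reverses the order of exactly one
pair, so it lowers the distance by at most one; and while the distance is positive, some pair of
consecutive candidates is ordered against `X`, so some swap lowers it by exactly one. Hence l_i ≤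
d_i swaps can bring the distance down to d_i - l_i and no further, and swaps beyond d_i are wasted
(`exists_swapsTo`, `kendallTau_le_of_swapsTo`).

What remains is a knapsack problem with items of equal value: there are d_i units of price
cost(R_i), and all but k of them must be bought within the budget. Buying the cheapest is optimal.
No sorting is needed: for every a, the sum of min(e, a) over all unit prices e, minus k·a, is a
lower bound for the price of such a purchase, and if a purchase is needed at all, the bound is
attained when a is the price of the last unit bought greedily. So it suffices to test one inequality
for each price a that occurs (`exists_affordable_iff`, `Instance.isYes_iff`).

There are at most n·m² units, so their prices can be listed one by one; budget, prices and k stay in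
binary, and each test takes additions, comparisons and one multiplication. The distance d_i is
obtained by removing the candidates of `X` one after the other from R_i and counting those that
stand before each (`inversions_eq_card`).

For the machine, a small structured language over stacks is compiled to `FinTM2` with one machine
step per program step (`exec_code`). Each routine gets a specification `Runs` with its final memory
and a step bound; these compose to `runs_decideBribery`, whose bound is a polynomial expression in
the input length. -/

/-! ### A structured language for multi-stack machines -/

namespace StackProgram

open Turing Function

variable {K A : Type}

/-- The contents of the stacks. -/
abbrev Memory (K A : Type) : Type := K → List A

/-- The top symbols of the stacks. -/
abbrev Heads (K A : Type) : Type := K → Option A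

/-- The top symbols of the stacks of `s`. -/
def heads (s : Memory K A) : Heads K A := fun k => (s k).head?

@[simp] theorem heads_apply (s : Memory K A) (k : K) : heads s k = (s k).head? := rfl

/-- Structured programs over stacks. Conditions and pushed symbols depend on the top symbols. -/
inductive Prog (K A : Type) : Type
  /-- push a symbol -/
  | push (k : K) (f : Heads K A → A) : Prog K A
  /-- drop the top symbol, if there is one -/
  | pop (k : K) : Prog K A
  /-- replace the top symbol -/
  | set (k : K) (f : Heads K A → A) : Prog K A
  /-- do nothing -/
  | skip : Prog K A
  /-- run two programs one after the other -/
  | seq (p q : Prog K A) : Prog K A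
  /-- branch -/
  | ite (c : Heads K A → Bool) (p q : Prog K A) : Prog K A
  /-- repeat while the condition holds -/
  | loop (c : Heads K A → Bool) (p : Prog K A) : Prog K A

/-! ### Semantics of programs with step counts. -/

section Exec

variable [DecidableEq K]

/-- `Exec p s s' t`: the program `p` turns `s` into `s'` in exactly `t` steps. -/
inductive Exec : Prog K A → Memory K A → Memory K A → ℕ → Prop
  | push (k f s) : Exec (.push k f) s (update s k (f (heads s) :: s k)) 1
  | pop (k s) : Exec (.pop k) s (update s k (s k).tail) 1
  | set (k f s) : Exec (.set k f) s (update s k (f (heads s) :: (s k).tail)) 1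
  | skip (s) : Exec .skip s s 1
  | seq {p q s s₁ s₂ t₁ t₂} :
      Exec p s s₁ t₁ → Exec q s₁ s₂ t₂ → Exec (.seq p q) s s₂ (t₁ + t₂)
  | ite_true {c p q s s' t} : c (heads s) = true → Exec p s s' t → Exec (.ite c p q) s s' (t + 1)
  | ite_false {c p q s s' t} : c (heads s) = false → Exec q s s' t → Exec (.ite c p q) s s' (t + 1)
  | loop_done {c p s} : c (heads s) = false → Exec (.loop c p) s s 1
  | loop_step {c p s s₁ s₂ t₁ t₂} : c (heads s) = true → Exec p s s₁ t₁ →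
      Exec (.loop c p) s₁ s₂ t₂ → Exec (.loop c p) s s₂ (t₁ + t₂ + 1)

/-- `Runs p s s' T`: the program `p` turns `s` into `s'` in at most `T` steps. -/
def Runs (p : Prog K A) (s s' : Memory K A) (T : ℕ) : Prop := ∃ t ≤ T, Exec p s s' t

namespace Runs

theorem push (k : K) (f : Heads K A → A) (s : Memory K A) :
    Runs (.push k f) s (update s k (f (heads s) :: s k)) 1 := ⟨1, le_rfl, .push k f s⟩

theorem pop (k : K) (s : Memory K A) : Runs (.pop k) s (update s k (s k).tail) 1 :=
  ⟨1, le_rfl, .pop k s⟩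

theorem set (k : K) (f : Heads K A → A) (s : Memory K A) :
    Runs (.set k f) s (update s k (f (heads s) :: (s k).tail)) 1 := ⟨1, le_rfl, .set k f s⟩

theorem skip (s : Memory K A) : Runs .skip s s 1 := ⟨1, le_rfl, .skip s⟩

variable {p q : Prog K A} {c : Heads K A → Bool} {s s₁ s₂ : Memory K A} {T T₁ T₂ : ℕ}

theorem seq (h₁ : Runs p s s₁ T₁) (h₂ : Runs q s₁ s₂ T₂) : Runs (.seq p q) s s₂ (T₁ + T₂) := by
  obtain ⟨t₁, l₁, e₁⟩ := h₁
  obtain ⟨t₂, l₂, e₂⟩ := h₂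
  exact ⟨t₁ + t₂, by omega, .seq e₁ e₂⟩

theorem ite_true (hc : c (heads s) = true) (h : Runs p s s₁ T) : Runs (.ite c p q) s s₁ (T + 1) := by
  obtain ⟨t, l, e⟩ := h
  exact ⟨t + 1, by omega, .ite_true hc e⟩

theorem ite_false (hc : c (heads s) = false) (h : Runs q s s₁ T) :
    Runs (.ite c p q) s s₁ (T + 1) := by
  obtain ⟨t, l, e⟩ := h
  exact ⟨t + 1, by omega, .ite_false hc e⟩

theorem loop_done (hc : c (heads s) = false) : Runs (.loop c p) s s 1 :=
  ⟨1, le_rfl, .loop_done hc⟩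

theorem loop_step (hc : c (heads s) = true) (h₁ : Runs p s s₁ T₁)
    (h₂ : Runs (.loop c p) s₁ s₂ T₂) : Runs (.loop c p) s s₂ (T₁ + T₂ + 1) := by
  obtain ⟨t₁, l₁, e₁⟩ := h₁
  obtain ⟨t₂, l₂, e₂⟩ := h₂
  exact ⟨t₁ + t₂ + 1, by omega, .loop_step hc e₁ e₂⟩

theorem mono (h : Runs p s s₁ T₁) (hT : T₁ ≤ T) : Runs p s s₁ T := by
  obtain ⟨t, l, e⟩ := h
  exact ⟨t, l.trans hT, e⟩

/-- The form in which specifications are obtained: chaining the parts of a program yields an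
unsimplified memory and time, and both are then adjusted. -/
theorem congr (h : Runs p s s₁ T₁) (hs : s₁ = s₂) (hT : T₁ ≤ T) : Runs p s s₂ T :=
  hs ▸ h.mono hT

end Runs

end Exec

/-! ### Compilation to `FinTM2` -/

namespace Prog

/-- The labels of the machine of a program. -/
def Label : Prog K A → Type
  | push _ _ => Unit
  | pop _ => Unit
  | set _ _ => Unit
  | skip => Unit
  | seq p q => p.Label ⊕ q.Label
  | ite _ p q => Option (p.Label ⊕ q.Label)
  | loop _ p => Option p.Label

/-- A program has finitely many labels. -/
@[reducible]
def fintypeLabel : (p : Prog K A) → Fintype p.Label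
  | push _ _ => inferInstanceAs (Fintype Unit)
  | pop _ => inferInstanceAs (Fintype Unit)
  | set _ _ => inferInstanceAs (Fintype Unit)
  | skip => inferInstanceAs (Fintype Unit)
  | seq p q =>
    haveI := p.fintypeLabel
    haveI := q.fintypeLabel
    inferInstanceAs (Fintype (p.Label ⊕ q.Label))
  | ite _ p q =>
    haveI := p.fintypeLabel
    haveI := q.fintypeLabel
    inferInstanceAs (Fintype (Option (p.Label ⊕ q.Label)))
  | loop _ p =>
    haveI := p.fintypeLabel
    inferInstanceAs (Fintype (Option p.Label))

instance (p : Prog K A) : Fintype p.Label := p.fintypeLabel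

/-- The label at which the machine of a program starts. -/
def entry : (p : Prog K A) → p.Label
  | push _ _ => ()
  | pop _ => ()
  | set _ _ => ()
  | skip => ()
  | seq p _ => Sum.inl p.entry
  | ite _ _ _ => none
  | loop _ _ => none

end Prog

/-- The alphabets of the stacks: an output stack is added to the stacks of the program. -/
abbrev StackAlphabet (K A B : Type) : Option K → Type
  | none => B
  | some _ => A

/-- Statements of the compiled machine, which stores the top symbols of the stacks. -/
abbrev Code (K A B Λ : Type) : Type := TM2.Stmt (StackAlphabet K A B) Λ (Heads K A)

variable {B Λ : Type}

/-- The stacks of the compiled machine. -/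
def extend (s : Memory K A) (o : List B) : ∀ k : Option K, List (StackAlphabet K A B k)
  | none => o
  | some k => s k

section Compile

variable [DecidableEq K]

/-- Store the top symbols of the stacks `ks`. -/
def readHeads (ks : List K) (q : Code K A B Λ) : Code K A B Λ :=
  ks.foldr (fun k q => .peek (some k) (fun v (o : Option A) => update v k o) q) q

theorem update_extend (s : Memory K A) (o : List B) (k : K) (l : List A) :
    update (extend s o) (some k) l = extend (update s k l) o := by
  funext j
  cases j with
  | none => exact update_of_ne (by simp) _ _
  | some j =>
    by_cases h : j = k
    · subst h
      exact (update_self (some j) l (extend s o)).trans (update_self j l s).symm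
    · exact (update_of_ne (a := some j) (by simpa using h) _ (extend s o)).trans
        (update_of_ne h l s : update s k l j = s j).symm

theorem stepAux_push (s : Memory K A) (o : List B) (k : K) (f : Heads K A → A)
    (q : Code K A B Λ) (v : Heads K A) :
    TM2.stepAux (.push (some k) f q) v (extend s o) =
      TM2.stepAux q v (extend (update s k (f v :: s k)) o) :=
  congrArg (TM2.stepAux q v) (update_extend s o k (f v :: s k))

theorem stepAux_pop (s : Memory K A) (o : List B) (k : K) (f : Heads K A → Option A → Heads K A)
    (q : Code K A B Λ) (v : Heads K A) :
    TM2.stepAux (.pop (some k) f q) v (extend s o) =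
      TM2.stepAux q (f v (s k).head?) (extend (update s k (s k).tail) o) :=
  congrArg (TM2.stepAux q (f v (s k).head?)) (update_extend s o k (s k).tail)

/-- Peeking leaves the stacks alone and overwrites only the stored heads listed in `ks`; taking all
stacks for `ks` discards the old state altogether. -/
theorem stepAux_readHeads (ks : List K) (q : Code K A B Λ) (v : Heads K A) (s : Memory K A)
    (o : List B) :
    TM2.stepAux (readHeads ks q) v (extend s o) =
      TM2.stepAux q (fun k => if k ∈ ks then heads s k else v k) (extend s o) := by
  induction ks generalizing v with
  | nil => simp [readHeads]
  | cons k ks ih =>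
    refine (ih (update v k (s k).head?)).trans ?_
    congr 1
    funext j
    by_cases h : j ∈ ks
    · simp [h]
    · by_cases h' : j = k
      · subst h'; simp [h, heads]
      · simp [h, h']

namespace Prog

/-- `t` steps of the machine `M` lead from `a` to `b`. -/
def Steps (M : Λ → Code K A B Λ) (t : ℕ)
    (a b : TM2.Cfg (StackAlphabet K A B) Λ (Heads K A)) : Prop :=
  (flip bind (TM2.step M))^[t] (some a) = some b

theorem Steps.trans {M : Λ → Code K A B Λ} {t₁ t₂ a b c} (h₁ : Steps M t₁ a b)
    (h₂ : Steps M t₂ b c) : Steps M (t₁ + t₂) a c := by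
  unfold Steps at *
  rw [Nat.add_comm, iterate_add_apply, h₁, h₂]

theorem Steps.one {M : Λ → Code K A B Λ} {l v s} :
    Steps M 1 ⟨some l, v, s⟩ (TM2.stepAux (M l) v s) := rfl

end Prog

variable [Fintype K]

/-- Store the top symbols of all stacks. -/
noncomputable def readAll (q : Code K A B Λ) : Code K A B Λ := readHeads Finset.univ.toList q

theorem stepAux_readAll (q : Code K A B Λ) (v : Heads K A) (s : Memory K A) (o : List B) :
    TM2.stepAux (readAll q) v (extend s o) = TM2.stepAux q (heads s) (extend s o) := by
  rw [readAll, stepAux_readHeads]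
  congr 1
  funext k
  simp

namespace Prog

/-- The statements of a program whose labels are embedded by `emb`, and which continues at
`exit`. -/
noncomputable def code : (p : Prog K A) → (p.Label → Λ) → Λ → p.Label → Code K A B Λ
  | push k f, _, exit, _ => readAll (.push (some k) f (.goto fun _ => exit))
  | pop k, _, exit, _ => .pop (some k) (fun v _ => v) (.goto fun _ => exit)
  | set k f, _, exit, _ =>
    readAll (.pop (some k) (fun v _ => v) (.push (some k) f (.goto fun _ => exit)))
  | skip, _, exit, _ => .goto fun _ => exit
  | seq p q, emb, exit, l =>
    Sum.elim (p.code (fun l => emb (Sum.inl l)) (emb (Sum.inr q.entry)))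
      (q.code (fun l => emb (Sum.inr l)) exit) l
  | ite c p q, emb, exit, l =>
    Option.elim l
      (readAll (.branch c (.goto fun _ => emb (some (Sum.inl p.entry)))
        (.goto fun _ => emb (some (Sum.inr q.entry)))))
      (Sum.elim (p.code (fun l => emb (some (Sum.inl l))) exit)
        (q.code (fun l => emb (some (Sum.inr l))) exit))
  | loop c p, emb, exit, l =>
    Option.elim l
      (readAll (.branch c (.goto fun _ => emb (some p.entry)) (.goto fun _ => exit)))
      (p.code (fun l => emb (some l)) (emb none))

/-- Time is preserved exactly because a single machine statement may chain all the peeks with the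
action and the jump. The stored heads `v` are arbitrary at the entry: every statement that consults
them reads them afresh. The body of a loop is compiled with the label of the loop as its exit, so
the induction must vary `exit`. -/
theorem exec_code {p : Prog K A} {s s' : Memory K A} {t : ℕ} (h : Exec p s s' t)
    (M : Λ → Code K A B Λ) (emb : p.Label → Λ) (exit : Λ)
    (hM : ∀ l, M (emb l) = p.code emb exit l) (o : List B) (v : Heads K A) :
    ∃ v', Steps M t ⟨some (emb p.entry), v, extend s o⟩ ⟨some exit, v', extend s' o⟩ := by
  induction h generalizing exit v with
  | push k f s =>
    refine ⟨heads s, ?_⟩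
    have := Steps.one (M := M) (l := emb (entry (push k f))) (v := v) (s := extend s o)
    rwa [hM, code, stepAux_readAll, stepAux_push] at this
  | pop k s =>
    refine ⟨v, ?_⟩
    have := Steps.one (M := M) (l := emb (entry (pop k))) (v := v) (s := extend s o)
    rwa [hM, code, stepAux_pop] at this
  | set k f s =>
    refine ⟨heads s, ?_⟩
    have := Steps.one (M := M) (l := emb (entry (set k f))) (v := v) (s := extend s o)
    rwa [hM, code, stepAux_readAll, stepAux_pop, stepAux_push, update_self, update_idem] at this
  | skip s =>
    refine ⟨v, ?_⟩
    have := Steps.one (M := M) (l := emb (entry skip)) (v := v) (s := extend s o)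
    rwa [hM, code, TM2.stepAux] at this
  | @seq p q s s₁ s₂ t₁ t₂ _ _ ih₁ ih₂ =>
    obtain ⟨v₁, e₁⟩ := ih₁ (fun l => emb (Sum.inl l)) (emb (Sum.inr q.entry))
      (fun l => hM (Sum.inl l)) v
    obtain ⟨v₂, e₂⟩ := ih₂ (fun l => emb (Sum.inr l)) exit (fun l => hM (Sum.inr l)) v₁
    exact ⟨v₂, e₁.trans e₂⟩
  | @ite_true c p q s s' t hc _ ih =>
    obtain ⟨v₁, e₁⟩ := ih (fun l => emb (some (Sum.inl l))) exit
      (fun l => hM (some (Sum.inl l))) (heads s)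
    have := Steps.one (M := M) (l := emb (entry (ite c p q))) (v := v) (s := extend s o)
    rw [hM, code] at this
    simp only [entry, Option.elim] at this
    rw [stepAux_readAll, TM2.stepAux, hc, cond_true, TM2.stepAux] at this
    exact ⟨v₁, Nat.add_comm 1 t ▸ this.trans e₁⟩
  | @ite_false c p q s s' t hc _ ih =>
    obtain ⟨v₁, e₁⟩ := ih (fun l => emb (some (Sum.inr l))) exit
      (fun l => hM (some (Sum.inr l))) (heads s)
    have := Steps.one (M := M) (l := emb (entry (ite c p q))) (v := v) (s := extend s o)
    rw [hM, code] at this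
    simp only [entry, Option.elim] at this
    rw [stepAux_readAll, TM2.stepAux, hc, cond_false, TM2.stepAux] at this
    exact ⟨v₁, Nat.add_comm 1 t ▸ this.trans e₁⟩
  | @loop_done c p s hc =>
    have := Steps.one (M := M) (l := emb (entry (loop c p))) (v := v) (s := extend s o)
    rw [hM, code] at this
    simp only [entry, Option.elim] at this
    rw [stepAux_readAll, TM2.stepAux, hc, cond_false, TM2.stepAux] at this
    exact ⟨_, this⟩
  | @loop_step c p s s₁ s₂ t₁ t₂ hc _ _ ih₁ ih₂ =>
    have := Steps.one (M := M) (l := emb (entry (loop c p))) (v := v) (s := extend s o)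
    rw [hM, code] at this
    simp only [entry, Option.elim] at this
    rw [stepAux_readAll, TM2.stepAux, hc, cond_true, TM2.stepAux] at this
    obtain ⟨v₁, e₁⟩ := ih₁ (fun l => emb (some l)) (emb none) (fun l => hM (some l)) (heads s)
    obtain ⟨v₂, e₂⟩ := ih₂ emb exit hM v₁
    exact ⟨v₂, by
      rw [show t₁ + t₂ + 1 = 1 + (t₁ + t₂) by omega]
      exact this.trans (e₁.trans e₂)⟩

/-! ### Input, output and halting of the compiled machine. -/

variable [Fintype A]

/-- The machine of a program: it gets its input on the stack `inp`, runs the program, and turns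
the top symbol of the stack `res` into its output. -/
noncomputable def machine (p : Prog K A) (inp res : K) (out : Option A → B) : FinTM2 where
  K := Option K
  k₀ := some inp
  k₁ := none
  Γ := StackAlphabet K A B
  Λ := Option p.Label
  main := some p.entry
  σ := Heads K A
  initialState := fun _ => none
  σFin := by classical infer_instance
  Γk₀Fin := inferInstanceAs (Fintype A)
  m l := l.elim
    (.pop (some res) (fun v (a : Option A) => update v res a)
      (.push none (fun v => out (v res)) (.load (fun _ _ => none) .halt)))
    (p.code some none)

/-- If the program leaves nothing but one symbol on the stack `res`, then its machine outputs the
symbol assigned to it. -/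
theorem machine_outputs {p : Prog K A} {inp res : K} {out : Option A → B} {w : List A} {a : A}
    {T : ℕ} (h : Runs p (update (fun _ => []) inp w) (update (fun _ => []) res [a]) T) :
    Nonempty (TM2OutputsInTime (p.machine inp res out) w (some [out (some a)]) (T + 1)) := by
  obtain ⟨t, ht, e⟩ := h
  obtain ⟨v, e'⟩ := exec_code e (p.machine inp res out).m some none (fun _ => rfl) [] fun _ => none
  have h₁ : initList (p.machine inp res out) w =
      ⟨some (some p.entry), fun _ => none, extend (update (fun _ => []) inp w) []⟩ := by
    unfold initList
    congr 1
    funext k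
    rcases k with _ | k
    · exact dif_neg (show ¬ (none = some inp) by simp)
    · by_cases hk : k = inp
      · subst hk
        exact (dif_pos (rfl : some k = some k)).trans (update_self k w fun _ => []).symm
      · exact (dif_neg (show ¬ (some k = some inp) by simpa using hk)).trans
          (update_of_ne hk w fun _ => []).symm
  -- A halting configuration has the initial state and no stack contents besides the output. This is
  -- why the program has to leave nothing but the symbol on `res`, which this last step removes, and
  -- why the stored heads are reset.
  have h₂ : TM2.stepAux ((p.machine inp res out).m none) v
      (extend (update (fun _ => []) res [a]) []) =
        haltList (p.machine inp res out) [out (some a)] := by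
    refine (stepAux_pop _ _ _ _ _ _).trans ?_
    rw [update_self, update_idem]
    unfold haltList
    refine congrArg₂ (TM2.Cfg.mk none) rfl ?_
    funext k
    rcases k with _ | k
    · refine Eq.trans ?_ (dif_pos (rfl : (none : Option K) = none)).symm
      refine (update_self none _ _).trans ?_
      exact congrArg (fun x => [out x]) (update_self res _ _)
    · refine Eq.trans ?_ (dif_neg (show ¬ (some k = (none : Option K)) by simp)).symm
      refine (update_of_ne (by simp) _ _).trans ?_
      exact congrFun (update_eq_self res (fun _ => ([] : List A))) k
  have last : Steps (p.machine inp res out).m 1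
      ⟨some none, v, extend (update (fun _ => []) res [a]) []⟩
        (haltList (p.machine inp res out) [out (some a)]) := h₂ ▸ Steps.one
  refine ⟨⟨⟨t + 1, ?_⟩, Nat.succ_le_succ ht⟩⟩
  rw [h₁]
  exact e'.trans last

/-- A program that computes `f` and has a polynomial step bound gives a polynomial time machine. -/
noncomputable def computableInPolyTime {α : Type} {ea : α → List A} {eb : B → List B} {f : α → B}
    (p : Prog K A) (inp res : K) (out : Option A → B) (time : Polynomial ℕ)
    (heb : ∀ b, eb b = [b])
    (h : ∀ x, ∃ a T, out (some a) = f x ∧ T + 1 ≤ time.eval (ea x).length ∧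
      Runs p (update (fun _ => []) inp (ea x)) (update (fun _ => []) res [a]) T) :
    TM2ComputableInPolyTime ea eb f where
  tm := p.machine inp res out
  inputAlphabet := Equiv.refl A
  outputAlphabet := Equiv.refl B
  time := time
  outputsFun x := by
    refine Classical.choice ?_
    obtain ⟨a, T, ha, hT, hr⟩ := h x
    obtain ⟨o⟩ := machine_outputs (out := out) hr
    have e₁ : List.map (Equiv.refl A).invFun (ea x) = ea x := List.map_id _
    have e₂ : List.map (Equiv.refl B).invFun (eb (f x)) = [out (some a)] := by
      rw [heb, ha]
      rfl
    -- The lists in the goal are typed by the alphabets of the machine, which agree with `A` and `B`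
    -- only by unfolding; generalizing them allows the substitution.
    have key : ∀ (w : List A) (w' : List B), w = ea x → w' = [out (some a)] →
        Nonempty (TM2OutputsInTime (p.machine inp res out) w (some w')
          (time.eval (ea x).length)) := by
      rintro _ _ rfl rfl
      exact ⟨⟨o.toEvalsTo, o.steps_le_m.trans hT⟩⟩
    exact key _ _ e₁ e₂

end Prog

end Compile

end StackProgram

/-! ### Routines on binary numbers -/

namespace SwapBribery

open Function StackProgram

/-- The digits of a number, as letters. -/
abbrev bits (x : List Bool) : List Letter := x.map Letter.bit

/-- The value of a binary number, least significant digit first. -/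
def value : List Bool → ℕ
  | [] => 0
  | b :: x => b.toNat + 2 * value x

theorem value_encodePosNum (n : PosNum) : value (Computability.encodePosNum n) = n := by
  induction n with
  | one => rfl
  | bit0 n ih => simp [Computability.encodePosNum, value, ih, PosNum.cast_bit0, two_mul]
  | bit1 n ih => simp [Computability.encodePosNum, value, ih, PosNum.cast_bit1]; ring

@[simp] theorem value_encodeNat (n : ℕ) : value (Computability.encodeNat n) = n := by
  unfold Computability.encodeNat Computability.encodeNum
  conv_rhs => rw [← Num.to_of_nat n]
  cases (n : Num) with
  | zero => rfl
  | pos p => simpa using value_encodePosNum p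

theorem value_eq_head_add_tail (x : List Bool) :
    value x = (x.headD false).toNat + 2 * value x.tail := by
  cases x <;> simp [value]

/-- Whether a letter is a binary digit. -/
def Letter.isBit : Letter → Bool
  | .bit _ => true
  | _ => false

/-- The binary digit that a top symbol stands for. -/
def digit : Option Letter → Bool
  | some (.bit b) => b
  | _ => false

/-- The invariant behind loops that take digits off one stack and keep them on another; it also
covers the shorter number once its stack is empty. -/
theorem reverse_tail_append {α : Type} (l r : List α) :
    l.tail.reverse ++ (l.head?.toList ++ r) = l.reverse ++ r := by
  cases l <;> simp

theorem digit_head_bits (x : List Bool) : digit (bits x).head? = x.headD false := by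
  cases x <;> rfl

section Routines

variable {K : Type}

/-- Run programs one after the other. -/
def block : List (Prog K Letter) → Prog K Letter
  | [] => .skip
  | [p] => p
  | p :: q :: l => .seq p (block (q :: l))

/-- Push the top symbol of `a` on `b`. -/
def pushTop (a b : K) : Prog K Letter := .push b fun h => (h a).getD .comma

/-- Move symbols from `a` to `b` while they satisfy `P`. -/
def moveWhile (P : Letter → Bool) (a b : K) : Prog K Letter :=
  .loop (fun h => (h a).any P) (.seq (pushTop a b) (.pop a))

/-- Move all symbols from `a` to `b`. -/
def moveAll (a b : K) : Prog K Letter := moveWhile (fun _ => true) a b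

/-- Move the top symbol of `a`, if there is one, to `b`. -/
def moveTop (a b : K) : Prog K Letter :=
  .ite (fun h => (h a).isSome) (.seq (pushTop a b) (.pop a)) .skip

/-- Push a copy of `a` on `b`, using the empty stack `t`. -/
def copy (a b t : K) : Prog K Letter :=
  .seq (moveAll a t)
    (.loop (fun h => (h t).isSome) (.seq (pushTop t a) (.seq (pushTop t b) (.pop t))))

/-- Empty the stack `a`. -/
def clear (a : K) : Prog K Letter := .loop (fun h => (h a).isSome) (.pop a)

/-- Move the number on the top of `a` to `b`, using the empty stack `t`, and drop the comma. -/
def readNumber (a b t : K) : Prog K Letter :=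
  .seq (moveWhile Letter.isBit a t) (.seq (.pop a) (moveAll t b))

/-- The letter that stands for the result of a comparison. -/
def flag : Ordering → Letter
  | .lt => .bit false
  | .eq => .comma
  | .gt => .bit true

/-- The result of a comparison after one more digit. -/
def nextFlag (x y o : Option Letter) : Letter :=
  match digit x, digit y with
  | true, false => flag .gt
  | false, true => flag .lt
  | _, _ => o.getD .comma

/-- Compare the numbers on the stacks `a` and `b`, leaving the result on the empty stack `f`. -/
def compareNumbers (a b t₁ t₂ f : K) : Prog K Letter :=
  .seq (.push f fun _ => flag .eq) <|
  .seq (.loop (fun h => (h a).isSome || (h b).isSome) <|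
    .seq (.set f fun h => nextFlag (h a) (h b) (h f)) <|
    .seq (moveTop a t₁) (moveTop b t₂)) <|
  .seq (moveAll t₁ a) (moveAll t₂ b)

/-- Add the top digits of `a` and `b` and the carry on `f`. -/
def addDigits (a b t₁ t₂ f : K) : Prog K Letter :=
  .seq (.push t₁ fun h => .bit (xor (xor (digit (h a)) (digit (h b))) (digit (h f)))) <|
  .seq (.set f fun h => .bit (Bool.atLeastTwo (digit (h a)) (digit (h b)) (digit (h f)))) <|
  .seq (.pop a) (moveTop b t₂)

/-- Add the number on the stack `b` to the number on the stack `a`. -/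
def addNumber (a b t₁ t₂ f : K) : Prog K Letter :=
  .seq (.push f fun _ => .bit false) <|
  .seq (.loop (fun h => (h a).isSome || (h b).isSome) (addDigits a b t₁ t₂ f)) <|
  .seq (pushTop f t₁) <| .seq (.pop f) <|
  .seq (moveAll t₁ a) (moveAll t₂ b)

/-! ### Correctness and step counts of the routines. -/

variable [DecidableEq K]

theorem runs_pushTop (a b : K) (s : Memory K Letter) {x : Letter} {w : List Letter}
    (h : s a = x :: w) : Runs (pushTop a b) s (update s b (x :: s b)) 1 :=
  (Runs.push _ _ _).congr (by simp [h]) le_rfl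

/-- Moving reverses the order, so the routines that have to preserve it move everything twice. The
condition on `rest` makes the loop stop right after `w`. -/
theorem runs_moveWhile {P : Letter → Bool} {a b : K} (hab : a ≠ b) (w rest : List Letter)
    (hw : ∀ x ∈ w, P x = true) (hrest : rest.head?.any P = false) (s : Memory K Letter)
    (hs : s a = w ++ rest) :
    Runs (moveWhile P a b) s (update (update s a rest) b (w.reverse ++ s b))
      (3 * w.length + 1) := by
  induction w generalizing s with
  | nil =>
    refine (Runs.loop_done (by simpa [hs] using hrest)).congr ?_ (by simp)
    funext k
    simp only [update_apply]
    split_ifs <;> simp_all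
  | cons x w ih =>
    refine (Runs.loop_step (by simp [hs, hw x]) ((runs_pushTop a b s hs).seq (.pop _ _))
      (ih (fun y hy => hw y (by simp [hy])) _ (by simp [hs, hab]))).congr ?_ (by simp; omega)
    funext k
    simp only [update_apply]
    split_ifs <;> simp_all

theorem runs_moveAll {a b : K} (hab : a ≠ b) (s : Memory K Letter) :
    Runs (moveAll a b) s (update (update s a []) b ((s a).reverse ++ s b))
      (3 * (s a).length + 1) :=
  runs_moveWhile hab (s a) [] (by simp) rfl s (by simp)

theorem runs_moveTop {a b : K} (hab : a ≠ b) (s : Memory K Letter) :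
    Runs (moveTop a b) s (update (update s a (s a).tail) b ((s a).head?.toList ++ s b)) 3 := by
  cases h : s a with
  | nil =>
    refine (Runs.ite_false (by simp [h]) (.skip s)).congr ?_ (by simp)
    funext k
    simp only [update_apply]
    split_ifs <;> simp_all
  | cons x w =>
    refine (Runs.ite_true (by simp [h]) ((runs_pushTop a b s h).seq (.pop _ _))).congr ?_
      (by simp)
    funext k
    simp only [update_apply]
    split_ifs <;> simp_all

theorem runs_clear (a : K) (s : Memory K Letter) :
    Runs (clear a) s (update s a []) (2 * (s a).length + 1) := by
  generalize hw : s a = w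
  induction w generalizing s with
  | nil =>
    refine (Runs.loop_done (by simp [hw])).congr ?_ (by simp)
    rw [← hw, update_eq_self]
  | cons x w ih =>
    refine (Runs.loop_step (by simp [hw]) (.pop _ _) (ih _ (by simp [hw]))).congr ?_
      (by simp; omega)
    simp

theorem runs_copy {a b t : K} (hab : a ≠ b) (hat : a ≠ t) (hbt : b ≠ t) (s : Memory K Letter)
    (ht : s t = []) :
    Runs (copy a b t) s (update s b (s a ++ s b)) (7 * (s a).length + 2) := by
  have key : ∀ (w : List Letter) (s : Memory K Letter), s t = w →
      Runs (.loop (fun h => (h t).isSome) (.seq (pushTop t a) (.seq (pushTop t b) (.pop t)))) s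
        (update (update (update s t []) a (w.reverse ++ s a)) b (w.reverse ++ s b))
        (4 * w.length + 1) := by
    intro w
    induction w with
    | nil =>
      intro s hw
      refine (Runs.loop_done (by simp [hw])).congr ?_ (by simp)
      funext k
      simp only [update_apply]
      split_ifs <;> simp_all
    | cons x w ih =>
      intro s hw
      refine (Runs.loop_step (by simp [hw]) ((runs_pushTop t a s hw).seq
        ((runs_pushTop t b (x := x) (w := w) _ (by simp [hw, hat.symm])).seq (.pop _ _)))
        (ih _ (by simp [hw, hat.symm, hbt.symm]))).congr ?_ (by simp; omega)
      funext k
      simp only [update_apply]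
      split_ifs <;> simp_all
  refine ((runs_moveAll hat s).seq (key (s a).reverse _ (by simp [ht]))).congr ?_
    (by simp; omega)
  funext k
  simp only [update_apply]
  split_ifs <;> simp_all

theorem runs_readNumber {a b t : K} (hab : a ≠ b) (hat : a ≠ t) (hbt : b ≠ t)
    (s : Memory K Letter) (ht : s t = []) (x : List Bool) (rest : List Letter)
    (hs : s a = bits x ++ Letter.comma :: rest) :
    Runs (readNumber a b t) s (update (update s a rest) b (bits x ++ s b))
      (6 * x.length + 3) := by
  refine ((runs_moveWhile hat (bits x) (.comma :: rest) (by
    intro y hy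
    obtain ⟨b, -, rfl⟩ := List.mem_map.1 hy
    rfl) rfl s hs).seq
    ((Runs.pop a _).seq (runs_moveAll hbt.symm _))).congr ?_ ?_
  · funext k
    simp only [update_apply]
    split_ifs <;> simp_all
  · simp [hat, hat.symm, ht]; omega

/-- Numbers are read from the least significant digit on: a later digit overrules the verdict so far
unless it is equal in both numbers. -/
theorem compare_digits (a b : Bool) (m n : ℕ) :
    compare (a.toNat + 2 * m) (b.toNat + 2 * n) = (compare m n).then (compare a b) := by
  rcases lt_trichotomy m n with h | rfl | h
  · rw [compare_lt_iff_lt.2 h, compare_lt_iff_lt.2]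
    · rfl
    · cases a <;> cases b <;> simp <;> omega
  · rw [compare_eq_iff_eq.2 rfl]
    cases a <;> cases b
    · simp
    · exact compare_lt_iff_lt.2 (by simp)
    · exact compare_gt_iff_gt.2 (by simp)
    · simp
  · rw [compare_gt_iff_gt.2 h, compare_gt_iff_gt.2]
    · rfl
    · cases a <;> cases b <;> simp <;> omega

theorem nextFlag_flag (x y : Option Letter) (o : Ordering) :
    nextFlag x y (some (flag o)) = flag ((compare (digit x) (digit y)).then o) := by
  unfold nextFlag
  cases digit x <;> cases digit y <;> rfl

theorem runs_compareNumbers {a b t₁ t₂ f : K} (hn : [a, b, t₁, t₂, f].Nodup)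
    (s : Memory K Letter) (h₁ : s t₁ = []) (h₂ : s t₂ = []) (hf : s f = []) (x y : List Bool)
    (ha : s a = bits x) (hb : s b = bits y) :
    Runs (compareNumbers a b t₁ t₂ f) s (update s f [flag (compare (value x) (value y))])
      (11 * (x.length + y.length) + 4) := by
  simp only [List.nodup_cons, List.mem_cons, List.not_mem_nil, or_false, not_or, not_false_iff,
    List.nodup_nil, and_true] at hn
  obtain ⟨⟨hab, ha1, ha2, haf⟩, ⟨hb1, hb2, hbf⟩, ⟨h12, h1f⟩, h2f⟩ := hn
  -- Here `o` is the verdict on the digits already passed, which are less significant than those of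
  -- `x` and `y`. The bound `n` is on the total number of digits left, since each turn removes at
  -- least one.
  have key : ∀ (n : ℕ) (x y : List Bool) (o : Ordering) (s : Memory K Letter),
      x.length + y.length ≤ n → s a = bits x → s b = bits y → s f = [flag o] →
      Runs (.loop (fun h => (h a).isSome || (h b).isSome) <|
        .seq (.set f fun h => nextFlag (h a) (h b) (h f)) <|
        .seq (moveTop a t₁) (moveTop b t₂)) s
        (update (update (update (update (update s a []) b []) t₁ ((bits x).reverse ++ s t₁)) t₂
          ((bits y).reverse ++ s t₂)) f [flag ((compare (value x) (value y)).then o)])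
        (8 * n + 1) := by
    intro n
    induction n with
    | zero =>
      intro x y o s hxy ha hb hf
      obtain rfl : x = [] := List.length_eq_zero_iff.1 (by omega)
      obtain rfl : y = [] := List.length_eq_zero_iff.1 (by omega)
      refine (Runs.loop_done (by simp [ha, hb])).congr ?_ (by simp)
      funext k
      simp only [update_apply]
      split_ifs <;> simp_all
    | succ n ih =>
      intro x y o s hxy ha hb hf
      by_cases hxy' : x.length + y.length = 0
      · exact (ih x y o s (by omega) ha hb hf).mono (by omega)
      have hc : ((heads s a).isSome || (heads s b).isSome) = true := by
        cases x <;> cases y <;> simp_all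
      have step : Runs (.seq (.set f fun h => nextFlag (h a) (h b) (h f)) <|
          .seq (moveTop a t₁) (moveTop b t₂)) s
          (update (update (update (update (update s f
            [flag ((compare (x.headD false) (y.headD false)).then o)]) a (bits x.tail)) b
            (bits y.tail)) t₁ ((bits x).head?.toList ++ s t₁)) t₂
            ((bits y).head?.toList ++ s t₂)) 7 := by
        refine ((Runs.set _ _ _).seq ((runs_moveTop ha1 _).seq
          (runs_moveTop hb2 _))).congr ?_ (by omega)
        simp only [heads_apply, hf, List.head?_cons, nextFlag_flag]
        rw [← digit_head_bits x, ← digit_head_bits y, ← ha, ← hb]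
        funext k
        simp only [update_apply]
        split_ifs <;> simp_all
      refine (Runs.loop_step hc step (ih x.tail y.tail
          ((compare (x.headD false) (y.headD false)).then o) _ ?_ ?_ ?_ ?_)).congr ?_ (by omega)
      · simp only [List.length_tail]; omega
      · simp [*]
      · simp [*]
      · simp [Ne.symm haf, Ne.symm hbf, Ne.symm h1f, Ne.symm h2f]
      · rw [value_eq_head_add_tail x, value_eq_head_add_tail y, compare_digits, Ordering.then_assoc]
        have hx := reverse_tail_append (bits x)
        have hy := reverse_tail_append (bits y)
        funext k
        simp only [update_apply]
        split_ifs <;> simp_all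
  refine ((Runs.push f _ s).seq ((key (x.length + y.length) x y .eq _ le_rfl ?_ ?_ ?_).seq
    ((runs_moveAll (Ne.symm ha1) _).seq (runs_moveAll (Ne.symm hb2) _)))).congr ?_ ?_
  · simp [haf, ha]
  · simp [hbf, hb]
  · simp [hf]
  · funext k
    simp only [update_apply]
    split_ifs <;> simp_all
  · simp [*, Ne.symm h12, Ne.symm ha2]
    omega

theorem value_cons_sum (c : Bool) (x y z : List Bool)
    (h : value z = (Bool.atLeastTwo (x.headD false) (y.headD false) c).toNat + value x.tail +
      value y.tail) :
    value (xor (xor (x.headD false) (y.headD false)) c :: z) = c.toNat + value x + value y := by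
  rw [value, h, value_eq_head_add_tail x, value_eq_head_add_tail y]
  cases x.headD false <;> cases y.headD false <;> cases c <;> simp [Bool.atLeastTwo] <;> ring

theorem runs_addDigits {a b t₁ t₂ f : K} (hn : [a, b, t₁, t₂, f].Nodup)
    (s : Memory K Letter) (x y : List Bool) (c : Bool)
    (ha : s a = bits x) (hb : s b = bits y) (hf : s f = [.bit c]) :
    Runs (addDigits a b t₁ t₂ f) s
      (update (update (update (update (update s f
        [.bit (Bool.atLeastTwo (x.headD false) (y.headD false) c)]) a (bits x.tail)) b
        (bits y.tail)) t₁ (.bit (xor (xor (x.headD false) (y.headD false)) c) :: s t₁)) t₂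
        ((bits y).head?.toList ++ s t₂)) 6 := by
  simp only [List.nodup_cons, List.mem_cons, List.not_mem_nil, or_false, not_or, not_false_iff,
    List.nodup_nil, and_true] at hn
  obtain ⟨⟨hab, ha1, ha2, haf⟩, ⟨hb1, hb2, hbf⟩, ⟨h12, h1f⟩, h2f⟩ := hn
  refine ((Runs.push _ _ _).seq ((Runs.set _ _ _).seq ((Runs.pop _ _).seq
    (runs_moveTop hb2 _)))).congr ?_ (by omega)
  rw [← digit_head_bits x, ← digit_head_bits y, ← ha, ← hb,
    show c = digit (s f).head? by rw [hf]; rfl]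
  funext k
  simp only [update_apply, heads_apply]
  split_ifs <;> simp_all

/-- School addition with incoming carry `c`: `z` are the digits of the sum and `d` is the final
carry, which becomes the top digit. Missing digits of the shorter number are read as zeros by
`digit`. The second summand is kept on `t₂` to be restored. -/
theorem runs_loop_addDigits {a b t₁ t₂ f : K} (hn : [a, b, t₁, t₂, f].Nodup) (n : ℕ)
    (s : Memory K Letter) (x y : List Bool) (c : Bool) (hxy : x.length + y.length ≤ n)
    (ha : s a = bits x) (hb : s b = bits y) (hf : s f = [.bit c]) :
    ∃ (z : List Bool) (d : Bool), value (z ++ [d]) = c.toNat + value x + value y ∧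
      z.length ≤ max x.length y.length ∧
      Runs (.loop (fun h => (h a).isSome || (h b).isSome) (addDigits a b t₁ t₂ f)) s
        (update (update (update (update (update s a []) b []) t₁ ((bits z).reverse ++ s t₁)) t₂
          ((bits y).reverse ++ s t₂)) f [.bit d])
        (7 * n + 1) := by
  induction n generalizing x y c s with
  | zero =>
    obtain rfl : x = [] := List.length_eq_zero_iff.1 (by omega)
    obtain rfl : y = [] := List.length_eq_zero_iff.1 (by omega)
    refine ⟨[], c, by simp [value], by simp,
      (Runs.loop_done (by simp [ha, hb])).congr ?_ (by simp)⟩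
    funext k
    simp only [update_apply]
    split_ifs <;> simp_all
  | succ n ih =>
    by_cases hxy' : x.length + y.length = 0
    · obtain ⟨z, d, hz, hl, hr⟩ := ih s x y c (by omega) ha hb hf
      exact ⟨z, d, hz, hl, hr.mono (by omega)⟩
    have hc : ((heads s a).isSome || (heads s b).isSome) = true := by
      cases x <;> cases y <;> simp_all
    have step := runs_addDigits hn s x y c ha hb hf
    simp only [List.nodup_cons, List.mem_cons, List.not_mem_nil, or_false, not_or, not_false_iff,
      List.nodup_nil, and_true] at hn
    obtain ⟨⟨hab, ha1, ha2, haf⟩, ⟨hb1, hb2, hbf⟩, ⟨h12, h1f⟩, h2f⟩ := hn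
    obtain ⟨z, d, hz, hl, hr⟩ := ih
      (update (update (update (update (update s f
          [.bit (Bool.atLeastTwo (x.headD false) (y.headD false) c)]) a (bits x.tail)) b
          (bits y.tail)) t₁ (.bit (xor (xor (x.headD false) (y.headD false)) c) :: s t₁)) t₂
          ((bits y).head?.toList ++ s t₂)) x.tail y.tail
      (Bool.atLeastTwo (x.headD false) (y.headD false) c)
      (by simp only [List.length_tail]; omega)
      (by simp [ha1, ha2, hab])
      (by simp [hb1, hb2])
      (by simp [Ne.symm haf, Ne.symm hbf, Ne.symm h1f, Ne.symm h2f])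
    refine ⟨xor (xor (x.headD false) (y.headD false)) c :: z, d,
      value_cons_sum c x y (z ++ [d]) hz, ?_, (Runs.loop_step hc step hr).congr ?_ (by omega)⟩
    · simp only [List.length_tail, List.length_cons] at hl ⊢
      omega
    · clear step hr ih
      have hy := reverse_tail_append (bits y)
      funext k
      simp only [update_apply]
      split_ifs <;> simp_all

theorem runs_addNumber {a b t₁ t₂ f : K} (hn : [a, b, t₁, t₂, f].Nodup)
    (s : Memory K Letter) (h₁ : s t₁ = []) (h₂ : s t₂ = []) (hf : s f = []) (x y : List Bool)
    (ha : s a = bits x) (hb : s b = bits y) :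
    ∃ z, value z = value x + value y ∧ z.length ≤ max x.length y.length + 1 ∧
      Runs (addNumber a b t₁ t₂ f) s (update s a (bits z)) (13 * (x.length + y.length) + 9) := by
  have hn' := hn
  simp only [List.nodup_cons, List.mem_cons, List.not_mem_nil, or_false, not_or, not_false_iff,
    List.nodup_nil, and_true] at hn'
  obtain ⟨⟨hab, ha1, ha2, haf⟩, ⟨hb1, hb2, hbf⟩, ⟨h12, h1f⟩, h2f⟩ := hn'
  obtain ⟨z, d, hz, hl, hr⟩ := runs_loop_addDigits hn (x.length + y.length)
    (update s f [.bit false]) x y false le_rfl (by simp [haf, ha]) (by simp [hbf, hb]) (by simp)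
  refine ⟨z ++ [d], by simpa using hz, by simpa using hl,
    (((Runs.push f _ s).congr (s₂ := update s f [.bit false]) (by rw [hf]) le_rfl).seq (hr.seq ((runs_pushTop f t₁ _ (x := .bit d) (w := [])
      (by simp)).seq ((Runs.pop f _).seq
        ((runs_moveAll (Ne.symm ha1) _).seq (runs_moveAll (Ne.symm hb2) _)))))).congr ?_ ?_⟩
  · clear hr
    funext k
    simp only [update_apply]
    split_ifs <;> simp_all
  · clear hr
    simp [*, Ne.symm ha2, Ne.symm h12]
    omega

end Routines

end SwapBribery

/-! ### The program: the costs of the single swaps -/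

namespace SwapBribery

open Function StackProgram Computability

/-- The number of pairs of elements whose order differs in the two lists. -/
def inversions : List ℕ → List ℕ → ℕ
  | [], _ => 0
  | a :: x, r => r.idxOf a + inversions x (r.erase a)

/-- The stacks of the program. -/
inductive Stack : Type
  | inp | bgt | kk | kk2 | xs | xc | rs | rs2 | c | e | ej | ei | v | w | l | r | t1 | t2 | f | ok
  deriving DecidableEq

open Stack

instance : Fintype Stack :=
  .ofList [inp, bgt, kk, kk2, xs, xc, rs, rs2, c, e, ej, ei, v, w, l, r, t1, t2, f, ok]
    fun a => by cases a <;> simp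

/-- A list of numbers, as a string. -/
def encodeNumbers (l : List ℕ) : List Letter := l.flatMap encodeNumber

@[simp] theorem encodeNumbers_nil : encodeNumbers [] = [] := rfl

@[simp] theorem encodeNumbers_cons (a : ℕ) (l : List ℕ) :
    encodeNumbers (a :: l) = bits (encodeNat a) ++ .comma :: encodeNumbers l := by
  simp [encodeNumbers, encodeNumber]

@[simp] theorem encodeNumbers_append (l₁ l₂ : List ℕ) :
    encodeNumbers (l₁ ++ l₂) = encodeNumbers l₁ ++ encodeNumbers l₂ := by
  simp [encodeNumbers]

theorem length_encodeNumbers_le {l : List ℕ} {N : ℕ} (h : ∀ a ∈ l, (encodeNat a).length ≤ N) :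
    (encodeNumbers l).length ≤ l.length * (N + 1) := by
  induction l with
  | nil => simp
  | cons a l ih =>
    have h₁ := ih fun b hb => h b (by simp [hb])
    have h₂ := h a (by simp)
    simp only [encodeNumbers_cons, List.length_append, List.length_map, List.length_cons]
    linarith

theorem semicolon_notMem_encodeNumbers (l : List ℕ) : Letter.semicolon ∉ encodeNumbers l := by
  induction l with
  | nil => simp
  | cons a l ih => simp [ih]

/-- Compare the candidate on `v` with the next candidate on `rs`. If they differ, move the latter
to `rs2` and push the cost on `e`. -/
def scanCandidate : Prog Stack Letter :=
  .seq (readNumber rs w t1) <|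
  .seq (compareNumbers v w t1 t2 f) <|
  .ite (fun h => h f == some .comma) (clear w) <|
  .seq (.pop f) <| .seq (moveAll w rs2) <| .seq (.push rs2 fun _ => .comma) <|
  .seq (.push e fun _ => .comma) (copy c e t1)

theorem runs_scanCandidate_eq {N : ℕ} (s : Memory Stack Letter) (x : ℕ) (rest : List Letter)
    (hr : s rs = bits (encodeNat x) ++ .comma :: rest) (hv : s v = bits (encodeNat x))
    (hw : s w = []) (h1 : s t1 = []) (h2 : s t2 = []) (hf : s f = [])
    (hx : (encodeNat x).length ≤ N) :
    Runs scanCandidate s (update (update s rs rest) f [.comma]) (38 * N + 14) := by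
  refine ((runs_readNumber (by decide) (by decide) (by decide) s h1 _ _ hr).seq
    ((runs_compareNumbers (by decide) _ ?_ ?_ ?_ (encodeNat x) (encodeNat x) ?_ ?_).seq
      (Runs.ite_true ?_ (runs_clear w _)))).congr ?_ ?_
  all_goals try simp [*, flag]
  · funext k
    cases k <;> simp [*]
  · omega

theorem flag_compare_ne {a b : ℕ} (h : a ≠ b) : flag (compare a b) ≠ .comma := by
  rcases Nat.lt_or_gt_of_ne h with h | h
  · rw [compare_lt_iff_lt.2 h]; simp [flag]
  · rw [compare_gt_iff_gt.2 h]; simp [flag]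

theorem runs_scanCandidate_ne {N : ℕ} (s : Memory Stack Letter) (x y : ℕ) (hxy : x ≠ y)
    (rest : List Letter) (hr : s rs = bits (encodeNat y) ++ .comma :: rest)
    (hv : s v = bits (encodeNat x))
    (hw : s w = []) (h1 : s t1 = []) (h2 : s t2 = []) (hf : s f = [])
    (hx : (encodeNat x).length ≤ N) (hy : (encodeNat y).length ≤ N) (hc : (s c).length ≤ N) :
    Runs scanCandidate s (update (update (update s rs rest) rs2
      (.comma :: ((bits (encodeNat y)).reverse ++ s rs2))) e (s c ++ .comma :: s e))
        (38 * N + 14) := by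
  have := flag_compare_ne hxy
  refine ((runs_readNumber (by decide) (by decide) (by decide) s h1 _ _ hr).seq
    ((runs_compareNumbers (by decide) _ ?_ ?_ ?_ (encodeNat x) (encodeNat y) ?_ ?_).seq
      (Runs.ite_false ?_ ((Runs.pop f _).seq ((runs_moveAll (by decide) _).seq
        ((Runs.push rs2 _ _).seq ((Runs.push e _ _).seq
          (runs_copy (by decide) (by decide) (by decide) _ ?_)))))))).congr ?_ ?_
  all_goals try simp [*]
  · funext k
    cases k <;> simp [*]
  · omega

/-- Search the candidate on `v` in the ranking on `rs`. -/
def findCandidate : Prog Stack Letter := .loop (fun h => (h f).isNone) scanCandidate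

/-- As `x` is not in `pre`, each candidate of `pre` is skipped and contributes one copy of the cost.
Skipped candidates lie reversed on `rs2`, ready to be moved back; the flag for equality stays on `f`
and ends the loop. -/
theorem runs_findCandidate {N : ℕ} (x cost : ℕ) (pre post es : List ℕ) (hpre : x ∉ pre)
    (s : Memory Stack Letter) (hr : s rs = encodeNumbers (pre ++ x :: post))
    (hv : s v = bits (encodeNat x)) (hc : s c = bits (encodeNat cost))
    (he : s e = encodeNumbers es)
    (hw : s w = []) (h1 : s t1 = []) (h2 : s t2 = []) (hf : s f = [])
    (hN : ∀ y ∈ cost :: x :: pre, (encodeNat y).length ≤ N) :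
    Runs findCandidate s (update (update (update (update s rs (encodeNumbers post)) rs2
      ((encodeNumbers pre).reverse ++ s rs2)) e
        (encodeNumbers (List.replicate pre.length cost ++ es))) f [.comma])
        ((pre.length + 1) * (38 * N + 15) + 1) := by
  induction pre generalizing s es with
  | nil =>
    refine (Runs.loop_step (by simp [hf]) (runs_scanCandidate_eq (N := N) s x (encodeNumbers post)
      (by simpa using hr) hv hw h1 h2 hf (hN x (by simp))) (Runs.loop_done (by simp))).congr ?_ ?_
    · funext k
      cases k <;> simp [*]
    · simp
  | cons y pre ih =>
    simp only [List.mem_cons, not_or] at hpre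
    refine (Runs.loop_step (by simp [hf]) (runs_scanCandidate_ne (N := N) s x y hpre.1
      (encodeNumbers (pre ++ x :: post)) (by simpa using hr) hv hw h1 h2 hf (hN x (by simp))
      (hN y (by simp)) (by simpa [hc] using hN cost (by simp)))
      (ih (es := cost :: es) hpre.2 _ ?_ ?_ ?_ ?_ ?_ ?_ ?_ ?_
        (fun z hz => hN z (by simp at hz ⊢; tauto)))).congr ?_ ?_
    all_goals try simp [*]
    · funext k
      cases k <;> simp [*, List.replicate_succ']
    · linarith

/-- Remove the candidate on the top of `xc` from the ranking on `rs`, and push the cost on `e` for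
each candidate before it. -/
def processCandidate : Prog Stack Letter :=
  .seq (readNumber xc v t1) <| .seq findCandidate <| .seq (.pop f) <|
  .seq (moveAll rs2 rs) (clear v)

theorem runs_processCandidate {N M : ℕ} (x cost : ℕ) (r es : List ℕ) (rest : List Letter)
    (hx : x ∈ r) (s : Memory Stack Letter)
    (hxc : s xc = bits (encodeNat x) ++ .comma :: rest) (hr : s rs = encodeNumbers r)
    (hc : s c = bits (encodeNat cost)) (he : s e = encodeNumbers es) (hv : s v = [])
    (hrs : s rs2 = []) (hw : s w = []) (h1 : s t1 = []) (h2 : s t2 = []) (hf : s f = [])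
    (hN : ∀ y ∈ cost :: r, (encodeNat y).length ≤ N) (hM : r.length ≤ M) :
    Runs processCandidate s (update (update (update s xc rest) rs (encodeNumbers (r.erase x))) e
      (encodeNumbers (List.replicate (r.idxOf x) cost ++ es)))
        (M * (38 * N + 15) + 3 * (M * (N + 1)) + 8 * N + 7) := by
  obtain ⟨pre, post, hpre, rfl, herase⟩ := List.exists_erase_eq hx
  rw [herase, List.idxOf_append_of_notMem hpre, List.idxOf_cons_self, Nat.add_zero]
  refine ((runs_readNumber (by decide) (by decide) (by decide) s h1 _ _ hxc).seq
    ((runs_findCandidate (N := N) x cost pre post es hpre _ ?_ ?_ ?_ ?_ ?_ ?_ ?_ ?_ ?_).seq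
      ((Runs.pop f _).seq ((runs_moveAll (by decide) _).seq (runs_clear v _))))).congr ?_ ?_
  all_goals try simp [*]
  · exact fun y hy => hN y (by simp [hy])
  · funext k
    cases k <;> simp [*]
  · have hx := hN x (by simp)
    have h₁ : (encodeNumbers pre).length ≤ pre.length * (N + 1) :=
      length_encodeNumbers_le fun y hy => hN y (by simp [hy])
    have h₂ : pre.length + 1 ≤ M := by
      simp only [List.length_append, List.length_cons] at hM
      omega
    have h₃ : pre.length * (N + 1) ≤ M * (N + 1) := Nat.mul_le_mul_right _ (by omega)
    have h₄ : (pre.length + 1) * (38 * N + 15) ≤ M * (38 * N + 15) :=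
      Nat.mul_le_mul_right _ h₂
    omega

/-- Push the cost on `e` once for each inversion of the rankings on `xc` and `rs`. -/
def processRanking : Prog Stack Letter := .loop (fun h => (h xc).isSome) processCandidate

/-- The loop follows the recursion of `inversions`. The rankings being permutations of each other,
every search succeeds, and this persists when the candidate found is erased from both. -/
theorem runs_processRanking {N M : ℕ} (cost : ℕ) (x r es : List ℕ) (hx : x.Perm r)
    (s : Memory Stack Letter) (hxc : s xc = encodeNumbers x) (hr : s rs = encodeNumbers r)
    (hc : s c = bits (encodeNat cost)) (he : s e = encodeNumbers es) (hv : s v = [])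
    (hrs : s rs2 = []) (hw : s w = []) (h1 : s t1 = []) (h2 : s t2 = []) (hf : s f = [])
    (hN : ∀ y ∈ cost :: r, (encodeNat y).length ≤ N) (hM : r.length ≤ M) :
    Runs processRanking s (update (update (update s xc []) rs []) e
      (encodeNumbers (List.replicate (inversions x r) cost ++ es)))
        (x.length * (M * (38 * N + 15) + 3 * (M * (N + 1)) + 8 * N + 8) + 1) := by
  induction x generalizing s r es with
  | nil =>
    obtain rfl := hx.nil_eq
    refine (Runs.loop_done (by simp [hxc])).congr ?_ (by simp)
    funext k
    cases k <;> simp [*, inversions]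
  | cons a x ih =>
    have ha : a ∈ r := hx.subset (by simp)
    refine (Runs.loop_step ?_ (runs_processCandidate (N := N) (M := M) a cost r es
      (encodeNumbers x) ha s (by simpa using hxc) hr hc he hv hrs hw h1 h2 hf hN hM)
      (ih (r.erase a) (List.replicate (r.idxOf a) cost ++ es) (List.cons_perm_iff_perm_erase.1 hx).2
        _ ?_ ?_ ?_ ?_ ?_ ?_ ?_ ?_ ?_ ?_ ?_ ?_)).congr ?_ ?_
    all_goals try simp [*]
    · exact fun y hy => hN y (by simp [List.mem_of_mem_erase hy])
    · exact hM.trans (Nat.le_succ M)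
    · rw [inversions, Nat.add_comm, List.replicate_add]
      funext k
      cases k <;> simp [*, -List.replicate_append_replicate]
    · linarith

/-- The string of a ranking that is given as a list. -/
def encodeRankingList (r : List ℕ) : List Letter := encodeNumbers r ++ [.semicolon]

/-- Move the ranking on the top of `inp` to `a`. -/
def readRanking (a : Stack) : Prog Stack Letter :=
  .seq (moveWhile (fun x => x != .semicolon) inp t1) (.seq (.pop inp) (moveAll t1 a))

theorem runs_readRanking (a : Stack) (ha₁ : a ≠ inp) (ha₂ : a ≠ t1) (s : Memory Stack Letter)
    (r : List ℕ) (rest : List Letter) (hs : s inp = encodeRankingList r ++ rest)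
    (h1 : s t1 = []) :
    Runs (readRanking a) s (update (update s inp rest) a (encodeNumbers r ++ s a))
      (6 * (encodeNumbers r).length + 3) := by
  have hr : ∀ x ∈ encodeNumbers r, (x != Letter.semicolon) = true := fun x hx => by
    have := semicolon_notMem_encodeNumbers r
    simp only [bne_iff_ne, ne_eq]
    rintro rfl
    exact this hx
  refine ((runs_moveWhile (by decide) (encodeNumbers r) (.semicolon :: rest) hr rfl s
    (by simpa [encodeRankingList] using hs)).seq ((Runs.pop inp _).seq
      (runs_moveAll ha₂.symm _))).congr ?_ ?_
  · funext k
    simp only [update_apply]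
    split_ifs <;> simp_all
  · simp [h1]
    omega

/-- Read a cost and a ranking, and push the cost on `e` once for each inversion of the ranking and
the one on `xs`. -/
def processVoter : Prog Stack Letter :=
  .seq (readNumber inp c t1) <| .seq (readRanking rs) <| .seq (copy xs xc t1) <|
  .seq processRanking (clear c)

/-- The string of a cost and a ranking. -/
def encodeVoter (p : ℕ × List ℕ) : List Letter := encodeNumber p.1 ++ encodeRankingList p.2

theorem runs_processVoter {N M : ℕ} (cost : ℕ) (x r es : List ℕ) (hx : x.Perm r)
    (rest : List Letter) (s : Memory Stack Letter) (hinp : s inp = encodeVoter (cost, r) ++ rest)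
    (hxs : s xs = encodeNumbers x) (hxc : s xc = []) (hr : s rs = [])
    (hc : s c = []) (he : s e = encodeNumbers es) (hv : s v = [])
    (hrs : s rs2 = []) (hw : s w = []) (h1 : s t1 = []) (h2 : s t2 = []) (hf : s f = [])
    (hN : ∀ y ∈ cost :: r, (encodeNat y).length ≤ N) (hM : r.length ≤ M) :
    Runs processVoter s (update (update s inp rest) e
      (encodeNumbers (List.replicate (inversions x r) cost ++ es)))
        (M * (M * (38 * N + 15) + 3 * (M * (N + 1)) + 8 * N + 8) + 13 * (M * (N + 1)) +
          8 * N + 10) := by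
  refine ((runs_readNumber (a := inp) (b := c) (t := t1) (by decide) (by decide) (by decide) s h1
      (encodeNat cost) (encodeRankingList r ++ rest)
      (by simpa [encodeVoter, encodeNumber] using hinp)).seq
    ((runs_readRanking rs (by decide) (by decide) _ r rest ?_ ?_).seq
      ((runs_copy (a := xs) (b := xc) (t := t1) (by decide) (by decide) (by decide) _ ?_).seq
        ((runs_processRanking (N := N) (M := M) cost x r es hx _ ?_ ?_ ?_ ?_ ?_ ?_ ?_ ?_ ?_ ?_ hN
          hM).seq (runs_clear c _))))).congr ?_ ?_
  all_goals try simp [*]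
  · funext k
    cases k <;> simp [*]
  · have hc := hN cost (by simp)
    have h₁ : (encodeNumbers r).length ≤ r.length * (N + 1) :=
      length_encodeNumbers_le fun y hy => hN y (by simp [hy])
    have h₂ : (encodeNumbers x).length ≤ x.length * (N + 1) :=
      length_encodeNumbers_le fun y hy => hN y (by simp [hx.subset hy])
    have h₃ : r.length * (N + 1) ≤ M * (N + 1) := Nat.mul_le_mul_right _ hM
    have h₄ : x.length * (M * (38 * N + 15) + 3 * (M * (N + 1)) + 8 * N + 8) ≤
        M * (M * (38 * N + 15) + 3 * (M * (N + 1)) + 8 * N + 8) :=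
      Nat.mul_le_mul_right _ (hx.length_eq ▸ hM)
    rw [hx.length_eq] at h₂ h₄ ⊢
    omega

/-- The costs of the single swaps that could be useful. -/
def unitCosts (x : List ℕ) (P : List (ℕ × List ℕ)) : List ℕ :=
  P.reverse.flatMap fun p => List.replicate (inversions x p.2) p.1

/-- Collect the costs of the useful swaps on `e`. -/
def processProfile : Prog Stack Letter := .loop (fun h => (h inp).isSome) processVoter

theorem runs_processProfile {N M : ℕ} (x es : List ℕ) (P : List (ℕ × List ℕ))
    (hP : ∀ p ∈ P, x.Perm p.2) (s : Memory Stack Letter) (hinp : s inp = P.flatMap encodeVoter)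
    (hxs : s xs = encodeNumbers x) (hxc : s xc = []) (hr : s rs = [])
    (hc : s c = []) (he : s e = encodeNumbers es) (hv : s v = [])
    (hrs : s rs2 = []) (hw : s w = []) (h1 : s t1 = []) (h2 : s t2 = []) (hf : s f = [])
    (hN : ∀ p ∈ P, ∀ y ∈ p.1 :: p.2, (encodeNat y).length ≤ N) (hM : x.length ≤ M) :
    Runs processProfile s (update (update s inp []) e (encodeNumbers (unitCosts x P ++ es)))
      (P.length * (M * (M * (38 * N + 15) + 3 * (M * (N + 1)) + 8 * N + 8) + 13 * (M * (N + 1)) +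
          8 * N + 11) + 1) := by
  induction P generalizing s es with
  | nil =>
    refine (Runs.loop_done (by simp [hinp])).congr ?_ (by simp)
    funext k
    cases k <;> simp [*, unitCosts]
  | cons p P ih =>
    have hp := hP p (by simp)
    refine (Runs.loop_step ?_ (runs_processVoter (N := N) (M := M) p.1 x p.2 es hp
      (P.flatMap encodeVoter) s (by simpa using hinp) hxs hxc hr hc he hv hrs hw h1 h2 hf
        (hN p (by simp)) (hp.length_eq ▸ hM))
      (ih (List.replicate (inversions x p.2) p.1 ++ es) (fun q hq => hP q (by simp [hq])) _
        ?_ ?_ ?_ ?_ ?_ ?_ ?_ ?_ ?_ ?_ ?_ ?_ fun q hq => hN q (by simp [hq]))).congr ?_ ?_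
    all_goals try simp [*]
    · cases h : encodeNat p.1 <;> simp [encodeVoter, encodeNumber, h]
    · funext k
      cases k <;> simp [*, unitCosts]
    · linarith

end SwapBribery

/-! ### The program: the comparison with the budget -/

namespace SwapBribery

open Function StackProgram Computability

open Stack

/-- Add the product of the numbers on `kk` and `w` to the number on `r`. -/
def addProduct : Prog Stack Letter :=
  .loop (fun h => (h kk).isSome) <|
    .seq (.ite (fun h => digit (h kk)) (addNumber r w t1 t2 f) .skip) <|
    .seq (.push w fun _ => .bit false) <| .seq (pushTop kk kk2) (.pop kk)

/-- Shift and add: a zero pushed on `w` doubles it, as the least significant digit is on top. The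
multiplier may be exponential in the input length, so repeated addition would not do. -/
theorem runs_addProduct {Q : ℕ} (n x y : List Bool) (s : Memory Stack Letter)
    (hk : s kk = bits n) (hr : s r = bits x) (hw : s w = bits y) (h1 : s t1 = [])
    (h2 : s t2 = []) (hf : s f = []) (hQ : max x.length y.length + n.length ≤ Q) :
    ∃ (z u : List Bool), value z = value x + value n * value y ∧
      z.length ≤ max x.length y.length + n.length ∧ u.length = n.length + y.length ∧
      Runs addProduct s (update (update (update (update s kk []) kk2
        ((bits n).reverse ++ s kk2)) r (bits z)) w (bits u)) (n.length * (26 * Q + 14) + 1) := by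
  induction n generalizing s x y with
  | nil =>
    refine ⟨x, y, by simp [value], by simp, by simp,
      (Runs.loop_done (by simp [hk])).congr ?_ (by simp)⟩
    funext k
    cases k <;> simp [*]
  | cons b n ih =>
    have step : ∃ z, value z = value x + b.toNat * value y ∧
        z.length ≤ max x.length y.length + 1 ∧
        Runs (.ite (fun h => digit (h kk)) (addNumber r w t1 t2 f) .skip) s
          (update s r (bits z)) (26 * Q + 10) := by
      cases b with
      | false =>
        refine ⟨x, by simp, by omega,
          (Runs.ite_false (by simp [hk, digit]) (.skip s)).congr ?_ (by omega)⟩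
        rw [← hr, update_eq_self]
      | true =>
        obtain ⟨z, hz, hl, hz'⟩ := runs_addNumber (a := r) (b := w) (t₁ := t1) (t₂ := t2)
          (f := f) (by decide) s h1 h2 hf x y hr hw
        exact ⟨z, by simpa using hz, hl, (Runs.ite_true (by simp [hk, digit]) hz').mono (by omega)⟩
    obtain ⟨z₁, hz₁, hl₁, hr₁⟩ := step
    have step₂ : Runs (.seq (.push w fun _ => .bit false) <| .seq (pushTop kk kk2) (.pop kk))
        (update s r (bits z₁)) (update (update (update (update s r (bits z₁)) w
          (bits (false :: y))) kk (bits n)) kk2 (.bit b :: s kk2)) 3 := by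
      refine ((Runs.push w _ _).seq ((runs_pushTop kk kk2 _ (x := .bit b) (w := bits n)
        (by simp [hk])).seq (Runs.pop kk _))).congr ?_ (by omega)
      funext k
      cases k <;> simp [*]
    -- One turn adds at most one digit to the larger of the two numbers and uses up one digit of the
    -- multiplier, so this quantity never grows.
    have hQ' : max z₁.length (y.length + 1) + n.length ≤ Q := by
      simp only [List.length_cons] at hQ
      omega
    obtain ⟨z, u, hz, hl, hu, hr₂⟩ := ih z₁ (false :: y) (update (update (update (update s r
      (bits z₁)) w (bits (false :: y))) kk (bits n)) kk2 (.bit b :: s kk2)) (by simp) (by simp)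
      (by simp) (by simp [h1]) (by simp [h2]) (by simp [hf]) (by simpa using hQ')
    refine ⟨z, u, ?_, ?_, ?_, (Runs.loop_step (by simp [hk]) (hr₁.seq step₂) hr₂).congr ?_ ?_⟩
    · rw [hz, hz₁]
      simp only [value]
      cases b <;> simp <;> ring
    · simp only [List.length_cons] at hl ⊢
      omega
    · simp only [List.length_cons] at hu ⊢
      omega
    · funext k
      cases k <;> simp [*]
    · simp only [List.length_cons]
      linarith

/-- Add the minimum of the number on `v` and the next number on `ei` to the number on `l`. -/
def addMin : Prog Stack Letter :=
  .seq (.seq (readNumber ei w t1) (compareNumbers v w t1 t2 f)) <|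
  .seq (.ite (fun h => h f == some (flag .lt)) (.seq (.pop f) (addNumber l v t1 t2 f))
    (.seq (.pop f) (addNumber l w t1 t2 f))) (clear w)

theorem runs_addMin {Q : ℕ} (a b : ℕ) (x : List Bool) (rest : List Letter)
    (s : Memory Stack Letter) (hei : s ei = bits (encodeNat b) ++ .comma :: rest)
    (hv : s v = bits (encodeNat a)) (hw : s w = []) (hl : s l = bits x) (h1 : s t1 = [])
    (h2 : s t2 = []) (hf : s f = []) (ha : (encodeNat a).length ≤ Q)
    (hb : (encodeNat b).length ≤ Q) (hx : x.length ≤ Q) :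
    ∃ z, value z = value x + min b a ∧
      z.length ≤ max x.length (max (encodeNat a).length (encodeNat b).length) + 1 ∧
      Runs addMin s (update (update s ei rest) l (bits z)) (56 * Q + 20) := by
  have first := (runs_readNumber (by decide) (by decide) (by decide) s h1 _ _ hei).seq
    (runs_compareNumbers (a := v) (b := w) (t₁ := t1) (t₂ := t2) (f := f) (by decide)
      (update (update s ei rest) w (bits (encodeNat b) ++ s w)) (by simp [h1]) (by simp [h2])
      (by simp [hf]) (encodeNat a) (encodeNat b) (by simp [hv]) (by simp [hw]))
  set s₁ : Memory Stack Letter := update (update s ei rest) w (bits (encodeNat b)) with hs₁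
  have second : ∃ z, value z = value x + min b a ∧
      z.length ≤ max x.length (max (encodeNat a).length (encodeNat b).length) + 1 ∧
      Runs (.ite (fun h => h f == some (flag .lt)) (.seq (.pop f) (addNumber l v t1 t2 f))
        (.seq (.pop f) (addNumber l w t1 t2 f))) (update s₁ f [flag (compare a b)])
        (update s₁ l (bits z)) (26 * Q + 11) := by
    have pop : Runs (.pop f) (update s₁ f [flag (compare a b)]) s₁ 1 :=
      (Runs.pop f _).congr (by funext k; cases k <;> simp [s₁, hf]) le_rfl
    by_cases hab : a < b
    · obtain ⟨z, hz, hzl, hzr⟩ := runs_addNumber (a := l) (b := v) (t₁ := t1) (t₂ := t2)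
        (f := f) (by decide) s₁ (by simp [s₁, h1]) (by simp [s₁, h2]) (by simp [s₁, hf]) x
        (encodeNat a) (by simp [s₁, hl]) (by simp [s₁, hv])
      refine ⟨z, by simpa [min_eq_right hab.le] using hz, by omega,
        (Runs.ite_true ?_ (pop.seq hzr)).mono (by omega)⟩
      simp [compare_lt_iff_lt.2 hab]
    · obtain ⟨z, hz, hzl, hzr⟩ := runs_addNumber (a := l) (b := w) (t₁ := t1) (t₂ := t2)
        (f := f) (by decide) s₁ (by simp [s₁, h1]) (by simp [s₁, h2]) (by simp [s₁, hf]) x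
        (encodeNat b) (by simp [s₁, hl]) (by simp [s₁])
      refine ⟨z, by simpa [min_eq_left (not_lt.1 hab)] using hz, by omega,
        (Runs.ite_false ?_ (pop.seq hzr)).mono (by omega)⟩
      rcases (not_lt.1 hab).eq_or_lt with h | h
      · simp [compare_eq_iff_eq.2 h.symm, flag]
      · simp [compare_gt_iff_gt.2 h, flag]
  obtain ⟨z, hz, hzl, hzr⟩ := second
  simp only [hw, List.append_nil, value_encodeNat, ← hs₁] at first
  refine ⟨z, hz, hzl, ((first.seq (hzr.seq (runs_clear w _)))).congr ?_ ?_⟩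
  · funext k
    cases k <;> simp [s₁, *]
  · simp [s₁]
    omega

/-- Add the minima of the number on `v` and the numbers on `ei` to the number on `l`. -/
def addMins : Prog Stack Letter := .loop (fun h => (h ei).isSome) addMin

/-- Each addition lengthens the running sum by at most one digit, so it stays short although there
are many summands. -/
theorem runs_addMins {N Q : ℕ} (a : ℕ) (es : List ℕ) (x : List Bool)
    (s : Memory Stack Letter) (hei : s ei = encodeNumbers es)
    (hv : s v = bits (encodeNat a)) (hw : s w = []) (hl : s l = bits x) (h1 : s t1 = [])
    (h2 : s t2 = []) (hf : s f = []) (hN : ∀ b ∈ a :: es, (encodeNat b).length ≤ N)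
    (hQ : max x.length N + es.length ≤ Q) :
    ∃ z, value z = value x + (es.map fun b => min b a).sum ∧
      z.length ≤ max x.length N + es.length ∧
      Runs addMins s (update (update s ei []) l (bits z)) (es.length * (56 * Q + 21) + 1) := by
  induction es generalizing s x with
  | nil =>
    refine ⟨x, by simp, by simp, (Runs.loop_done (by simp [hei])).congr ?_ (by simp)⟩
    funext k
    cases k <;> simp [*]
  | cons b es ih =>
    have ha := hN a (by simp)
    have hb := hN b (by simp)
    simp only [List.length_cons] at hQ
    obtain ⟨z₁, hz₁, hl₁, hr₁⟩ := runs_addMin (Q := Q) a b x (encodeNumbers es) s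
      (by simpa using hei) hv hw hl h1 h2 hf (by omega) (by omega) (by omega)
    obtain ⟨z, hz, hzl, hzr⟩ := ih z₁ (update (update s ei (encodeNumbers es)) l (bits z₁))
      (by simp) (by simp [hv]) (by simp [hw]) (by simp) (by simp [h1]) (by simp [h2])
      (by simp [hf]) (fun c hc => hN c (by simp at hc ⊢; tauto)) (by omega)
    refine ⟨z, ?_, ?_, (Runs.loop_step ?_ hr₁ hzr).congr ?_ ?_⟩
    · rw [hz, hz₁]
      simp [Nat.add_assoc]
    · simp only [List.length_cons]
      omega
    · simp [hei]
    · funext k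
      cases k <;> simp [*]
    · simp only [List.length_cons]
      linarith

/-- The inequality that is tested for the cost `a`. -/
def Affordable (b n : ℕ) (es : List ℕ) (a : ℕ) : Prop :=
  (es.map fun e => min e a).sum ≤ b + n * a

instance (b n : ℕ) (es : List ℕ) : DecidablePred (Affordable b n es) :=
  fun _ => inferInstanceAs (Decidable (_ ≤ _))

/-- Compute the two sides of the inequality for the next cost on `ej`. -/
def computeSides : Prog Stack Letter :=
  .seq (readNumber ej v t1) <| .seq (copy bgt r t1) <| .seq (copy v w t1) <|
  .seq addProduct <| .seq (moveAll kk2 kk) <| .seq (clear w) <| .seq (copy e ei t1) addMins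

/-- The requirement on `Q` covers both sides of the inequality: a sum of `es.length` minima has at
most `N + es.length` digits, and the budget plus a product of two numbers of at most `N` digits is
computed with at most `2 * N`. -/
theorem runs_computeSides {N Q : ℕ} (a b n : ℕ) (es : List ℕ) (rest : List Letter)
    (s : Memory Stack Letter) (hej : s ej = bits (encodeNat a) ++ .comma :: rest)
    (hbgt : s bgt = bits (encodeNat b)) (hk : s kk = bits (encodeNat n)) (hk2 : s kk2 = [])
    (he : s e = encodeNumbers es) (hei : s ei = [])
    (hv : s v = []) (hw : s w = []) (hl : s l = []) (hr : s r = []) (h1 : s t1 = [])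
    (h2 : s t2 = []) (hf : s f = []) (hN : ∀ c ∈ a :: b :: n :: es, (encodeNat c).length ≤ N)
    (hQ : 2 * N + es.length ≤ Q) :
    ∃ x y, value x = (es.map fun e => min e a).sum ∧ value y = b + n * a ∧
      x.length ≤ Q ∧ y.length ≤ Q ∧
      Runs computeSides s (update (update (update (update s ej rest) v (bits (encodeNat a))) l
        (bits x)) r (bits y))
        (N * (26 * Q + 14) + es.length * (56 * Q + 21) + 7 * (es.length * (N + 1)) + 27 * N +
          14) := by
  have ha := hN a (by simp)
  have hb := hN b (by simp)
  have hn := hN n (by simp)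
  have hes : (encodeNumbers es).length ≤ es.length * (N + 1) :=
    length_encodeNumbers_le fun c hc => hN c (by simp [hc])
  have h₁ := runs_readNumber (a := ej) (b := v) (t := t1) (by decide) (by decide) (by decide) s h1
    _ _ hej
  have h₂ := runs_copy (a := bgt) (b := r) (t := t1) (by decide) (by decide) (by decide)
    (update (update s ej rest) v (bits (encodeNat a) ++ s v)) (by simp [h1])
  have h₃ := runs_copy (a := v) (b := w) (t := t1) (by decide) (by decide) (by decide)
    (update (update (update s ej rest) v (bits (encodeNat a))) r (bits (encodeNat b)))
    (by simp [h1])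
  obtain ⟨y, u, hy, hyl, hu, h₄⟩ := runs_addProduct (Q := Q) (encodeNat n) (encodeNat b)
    (encodeNat a) (update (update (update (update s ej rest) v (bits (encodeNat a))) r
      (bits (encodeNat b))) w (bits (encodeNat a)))
    (by simp [hk]) (by simp) (by simp) (by simp [h1]) (by simp [h2]) (by simp [hf]) (by omega)
  have h₅ := runs_moveAll (a := kk2) (b := kk) (by decide)
    (update (update (update (update (update (update s ej rest) v (bits (encodeNat a))) kk [])
      kk2 (bits (encodeNat n)).reverse) r (bits y)) w (bits u))
  have h₆ := runs_clear w
    (update (update (update (update s ej rest) v (bits (encodeNat a))) r (bits y)) w (bits u))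
  have h₇ := runs_copy (a := e) (b := ei) (t := t1) (by decide) (by decide) (by decide)
    (update (update (update s ej rest) v (bits (encodeNat a))) r (bits y)) (by simp [h1])
  obtain ⟨x, hx, hxl, h₈⟩ := runs_addMins (N := N) (Q := Q) a es [] (update (update (update
    (update s ej rest) v (bits (encodeNat a))) r (bits y)) ei (encodeNumbers es))
    (by simp) (by simp) (by simp [hw]) (by simp [hl]) (by simp [h1]) (by simp [h2])
    (by simp [hf]) (fun c hc => hN c (by simp at hc ⊢; tauto)) (by simp; omega)
  simp only [value_encodeNat] at hy
  have h₄' : (encodeNat n).length * (26 * Q + 14) ≤ N * (26 * Q + 14) := Nat.mul_le_mul_right _ hn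
  refine ⟨x, y, by simpa [value] using hx, hy, ?_, by omega, ?_⟩
  · simp at hxl
    omega
  refine ((h₁.congr ?_ le_rfl).seq ((h₂.congr ?_ le_rfl).seq ((h₃.congr ?_ le_rfl).seq
    ((h₄.congr ?_ le_rfl).seq ((h₅.congr ?_ le_rfl).seq ((h₆.congr ?_ le_rfl).seq
      ((h₇.congr ?_ le_rfl).seq h₈))))))).congr ?_ ?_
  any_goals
    funext k
    cases k <;> simp [*]
  simp [hbgt, he]
  omega

/-- Test the inequality for the next cost on `ej`. -/
def testCost : Prog Stack Letter :=
  .seq computeSides <| .seq (compareNumbers l r t1 t2 f) <|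
  .seq (.ite (fun h => h f == some (flag .gt)) (.set ok fun _ => .bit false) .skip) <|
  .seq (.pop f) <| .seq (clear l) <| .seq (clear r) (clear v)

/-- The symbol on `ok` is only ever overwritten by `false`, so it accumulates the conjunction of all
tests. -/
theorem runs_testCost {N Q : ℕ} (a b n : ℕ) (es : List ℕ) (rest : List Letter) (o : Bool)
    (s : Memory Stack Letter) (hej : s ej = bits (encodeNat a) ++ .comma :: rest)
    (hbgt : s bgt = bits (encodeNat b)) (hk : s kk = bits (encodeNat n)) (hk2 : s kk2 = [])
    (he : s e = encodeNumbers es) (hei : s ei = [])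
    (hv : s v = []) (hw : s w = []) (hl : s l = []) (hr : s r = []) (h1 : s t1 = [])
    (h2 : s t2 = []) (hf : s f = []) (hok : s ok = [.bit o])
    (hN : ∀ c ∈ a :: b :: n :: es, (encodeNat c).length ≤ N)
    (hQ : 2 * N + es.length ≤ Q) :
    Runs testCost s (update (update s ej rest) ok [.bit (o && decide (Affordable b n es a))])
      (N * (26 * Q + 14) + es.length * (56 * Q + 21) + 7 * (es.length * (N + 1)) + 29 * N +
        26 * Q + 24) := by
  have ha := hN a (by simp)
  obtain ⟨x, y, hx, hy, hxl, hyl, h₁⟩ := runs_computeSides (N := N) (Q := Q) a b n es rest s hej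
    hbgt hk hk2 he hei hv hw hl hr h1 h2 hf hN hQ
  set s₁ := update (update (update (update s ej rest) v (bits (encodeNat a))) l
        (bits x)) r (bits y) with hs₁
  have h₂ := runs_compareNumbers (a := l) (b := r) (t₁ := t1) (t₂ := t2) (f := f) (by decide) s₁
    (by simp [s₁, h1]) (by simp [s₁, h2]) (by simp [s₁, hf]) x y (by simp [s₁]) (by simp [s₁])
  have h₃ : Runs (.ite (fun h => h f == some (flag .gt)) (.set ok fun _ => .bit false) .skip)
      (update s₁ f [flag (compare (value x) (value y))])
      (update (update s₁ f [flag (compare (value x) (value y))]) ok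
        [.bit (o && decide (Affordable b n es a))]) 2 := by
    by_cases hxy : Affordable b n es a
    · refine (Runs.ite_false ?_ (.skip _)).congr ?_ le_rfl
      · rw [Affordable, ← hx, ← hy] at hxy
        rcases hxy.eq_or_lt with h | h
        · simp [compare_eq_iff_eq.2 h, flag]
        · simp [compare_lt_iff_lt.2 h, flag]
      · funext k
        cases k <;> simp [s₁, *]
    · refine (Runs.ite_true ?_ (.set _ _ _)).congr ?_ le_rfl
      · rw [Affordable, ← hx, ← hy, not_le] at hxy
        simp [compare_gt_iff_gt.2 hxy]
      · funext k
        cases k <;> simp [s₁, *]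
  refine (h₁.seq (h₂.seq (h₃.seq ((Runs.pop f _).seq ((runs_clear l _).seq
    ((runs_clear r _).seq (runs_clear v _))))))).congr ?_ ?_
  · funext k
    cases k <;> simp [s₁, *]
  · simp [s₁]
    omega

/-- Test the inequality for all costs on `ej`. -/
def testCosts : Prog Stack Letter := .loop (fun h => (h ej).isSome) testCost

theorem runs_testCosts {N Q : ℕ} (b n : ℕ) (es as : List ℕ) (o : Bool)
    (s : Memory Stack Letter) (hej : s ej = encodeNumbers as)
    (hbgt : s bgt = bits (encodeNat b)) (hk : s kk = bits (encodeNat n)) (hk2 : s kk2 = [])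
    (he : s e = encodeNumbers es) (hei : s ei = [])
    (hv : s v = []) (hw : s w = []) (hl : s l = []) (hr : s r = []) (h1 : s t1 = [])
    (h2 : s t2 = []) (hf : s f = []) (hok : s ok = [.bit o])
    (hN : ∀ c ∈ b :: n :: es, (encodeNat c).length ≤ N)
    (has : ∀ a ∈ as, (encodeNat a).length ≤ N) (hQ : 2 * N + es.length ≤ Q) :
    Runs testCosts s (update (update s ej []) ok
        [.bit (o && decide (∀ a ∈ as, Affordable b n es a))])
      (as.length * (N * (26 * Q + 14) + es.length * (56 * Q + 21) + 7 * (es.length * (N + 1)) +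
        29 * N + 26 * Q + 25) + 1) := by
  induction as generalizing s o with
  | nil =>
    refine (Runs.loop_done (by simp [hej])).congr ?_ (by simp)
    funext k
    cases k <;> simp [*]
  | cons a as ih =>
    refine (Runs.loop_step (by simp [hej]) (runs_testCost (N := N) (Q := Q) a b n es
      (encodeNumbers as) o s (by simpa using hej) hbgt hk hk2 he hei hv hw hl hr h1 h2 hf hok
        (fun c hc => ?_) hQ)
      (ih (o && decide (Affordable b n es a)) _ ?_ ?_ ?_ ?_ ?_ ?_ ?_ ?_ ?_ ?_ ?_ ?_ ?_ ?_
        fun c hc => has c (by simp [hc]))).congr ?_ ?_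
    · rcases List.mem_cons.1 hc with rfl | hc
      exacts [has _ (by simp), hN _ hc]
    any_goals simp [*]
    · funext k
      cases k <;> simp [*, Bool.and_assoc]
    · linarith

end SwapBribery

/-! ### The whole program -/

namespace SwapBribery

open Function StackProgram Computability

open Stack

/-- Read the budget, the bound and the target ranking. -/
def readHeader : Prog Stack Letter :=
  .seq (readNumber inp bgt t1) <| .seq (.push ok fun h => .bit (!digit (h inp))) <|
  .seq (.pop inp) <| .seq (readNumber inp kk t1) (readRanking xs)

/-- Empty the stacks that are still in use after the tests. -/
def clearUp : Prog Stack Letter :=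
  .seq (clear e) <| .seq (clear bgt) <| .seq (clear kk) (clear xs)

/-- The program that decides the problem. -/
def decideBribery : Prog Stack Letter :=
  .seq readHeader <| .seq processProfile <| .seq (copy e ej t1) <| .seq testCosts clearUp

/-- The number of steps of the program, in terms of the length of numbers, the number of
candidates, the number of voters, and the number of useful swaps. -/
def stepBound {R : Type} [CommSemiring R] (N M p U : R) : R :=
  (6 * N + 3) + 2 + (6 * N + 3) + (6 * (M * (N + 1)) + 3) +
  (p * (M * (M * (38 * N + 15) + 3 * (M * (N + 1)) + 8 * N + 8) + 13 * (M * (N + 1)) +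
    8 * N + 11) + 1) +
  (7 * (U * (N + 1)) + 2) +
  (U * (N * (26 * (2 * N + U) + 14) + U * (56 * (2 * N + U) + 21) + 7 * (U * (N + 1)) +
    29 * N + 26 * (2 * N + U) + 25) + 1) +
  (2 * (U * (N + 1)) + 2 * N + 2 * N + 2 * (M * (N + 1)) + 4)

theorem stepBound_mono {N N' M M' p p' U U' : ℕ} (hN : N ≤ N') (hM : M ≤ M') (hp : p ≤ p')
    (hU : U ≤ U') : stepBound N M p U ≤ stepBound N' M' p' U' := by
  unfold stepBound
  gcongr

/-- A negative bound can never be met, so the negated sign bit serves as the initial verdict on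
`ok`, and afterwards the absolute value can stand for the bound. -/
theorem runs_readHeader (b n : ℕ) (neg : Bool) (x : List ℕ) (rest : List Letter) {N M : ℕ}
    (hb : (encodeNat b).length ≤ N) (hn : (encodeNat n).length ≤ N)
    (hx : ∀ c ∈ x, (encodeNat c).length ≤ N) (hM : x.length ≤ M) :
    Runs readHeader (update (fun _ => []) inp (encodeNumber b ++ .bit neg :: encodeNumber n ++
      encodeRankingList x ++ rest))
      (update (update (update (update (update (fun _ => []) inp rest) bgt (bits (encodeNat b))) kk
        (bits (encodeNat n))) xs (encodeNumbers x)) ok [.bit !neg])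
      ((6 * N + 3) + 2 + (6 * N + 3) + (6 * (M * (N + 1)) + 3)) := by
  have h₁ := length_encodeNumbers_le hx
  have h₂ : x.length * (N + 1) ≤ M * (N + 1) := Nat.mul_le_mul_right _ hM
  refine ((runs_readNumber (a := inp) (b := bgt) (t := t1) (by decide) (by decide) (by decide) _
    (by simp) (encodeNat b) (.bit neg :: encodeNumber n ++ encodeRankingList x ++ rest)
    (by simp [encodeNumber])).seq
    ((Runs.push ok _ _).seq ((Runs.pop inp _).seq ((runs_readNumber (a := inp) (b := kk) (t := t1)
      (by decide) (by decide) (by decide) _ (by simp) (encodeNat n)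
      (encodeRankingList x ++ rest) (by simp [encodeNumber])).seq
      (runs_readRanking xs (by decide) (by decide) _ x rest (by simp) (by simp)))))).congr ?_ ?_
  · funext k
    cases k <;> simp [digit]
  · omega

theorem runs_clearUp (s : Memory Stack Letter) :
    Runs clearUp s (update (update (update (update s e []) bgt []) kk []) xs [])
      (2 * (s e).length + 2 * (s bgt).length + 2 * (s kk).length + 2 * (s xs).length + 4) := by
  refine ((runs_clear e _).seq ((runs_clear bgt _).seq ((runs_clear kk _).seq
    (runs_clear xs _)))).mono ?_
  simp
  omega

theorem mem_unitCosts {x : List ℕ} {P : List (ℕ × List ℕ)} {a : ℕ} (h : a ∈ unitCosts x P) :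
    ∃ p ∈ P, p.1 = a := by
  simp only [unitCosts, List.mem_flatMap, List.mem_reverse, List.mem_replicate] at h
  obtain ⟨p, hp, -, rfl⟩ := h
  exact ⟨p, hp, rfl⟩

theorem runs_decideBribery (b n : ℕ) (neg : Bool) (x : List ℕ) (P : List (ℕ × List ℕ)) {N : ℕ}
    (hb : (encodeNat b).length ≤ N) (hn : (encodeNat n).length ≤ N)
    (hx : ∀ c ∈ x, (encodeNat c).length ≤ N) (hP : ∀ p ∈ P, x.Perm p.2)
    (hc : ∀ p ∈ P, (encodeNat p.1).length ≤ N) :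
    Runs decideBribery (update (fun _ => []) inp (encodeNumber b ++ .bit neg :: encodeNumber n ++
      encodeRankingList x ++ P.flatMap encodeVoter))
      (update (fun _ => []) ok
        [.bit (!neg && decide (∀ a ∈ unitCosts x P, Affordable b n (unitCosts x P) a))])
      (stepBound N x.length P.length (unitCosts x P).length) := by
  have hU : ∀ a ∈ unitCosts x P, (encodeNat a).length ≤ N := fun a ha => by
    obtain ⟨p, hp, rfl⟩ := mem_unitCosts ha
    exact hc p hp
  have h₁ := length_encodeNumbers_le hx
  have h₂ := length_encodeNumbers_le hU
  refine ((runs_readHeader b n neg x (P.flatMap encodeVoter) (N := N) (M := x.length) hb hn hx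
    le_rfl).seq ((runs_processProfile (N := N) (M := x.length) x [] P hP _ ?_ ?_ ?_ ?_ ?_ ?_ ?_ ?_
      ?_ ?_ ?_ ?_ ?_ le_rfl).seq ((runs_copy (a := e) (b := ej) (t := t1) (by decide) (by decide)
        (by decide) _ ?_).seq ((runs_testCosts (N := N) (Q := 2 * N + (unitCosts x P).length) b n
          (unitCosts x P) (unitCosts x P) (!neg) _ ?_ ?_ ?_ ?_ ?_ ?_ ?_ ?_ ?_ ?_ ?_ ?_ ?_ ?_ ?_ hU
            le_rfl).seq (runs_clearUp _))))).congr ?_ ?_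
  any_goals simp [*]
  · intro a r har
    exact ⟨hc _ har, fun c hc => hx c ((hP _ har).symm.subset hc)⟩
  · exact hU
  · funext k
    cases k <;> simp
  · unfold stepBound
    omega

/-- The polynomial bound that justifies listing the units one by one: each candidate has at most as
many candidates before it as the ranking has entries. -/
theorem length_unitCosts_le (x : List ℕ) (P : List (ℕ × List ℕ)) (hP : ∀ p ∈ P, x.Perm p.2) :
    (unitCosts x P).length ≤ P.length * (x.length * x.length) := by
  have key : ∀ (x r : List ℕ), x.Perm r → inversions x r ≤ x.length * r.length := by
    intro x
    induction x with
    | nil => simp [inversions]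
    | cons a x ih =>
      intro r hr
      have h := ih _ (List.cons_perm_iff_perm_erase.1 hr).2
      have h₁ : r.idxOf a ≤ r.length := List.idxOf_le_length
      have h₂ : x.length * (r.erase a).length ≤ x.length * r.length :=
        Nat.mul_le_mul_left _ List.length_erase_le
      simp only [inversions, List.length_cons]
      linarith
  simp only [unitCosts, List.length_flatMap, List.length_replicate, List.map_reverse,
    List.sum_reverse]
  have := List.sum_le_card_nsmul (P.map fun p => inversions x p.2) (x.length * x.length) (by
    simp only [List.mem_map]
    rintro _ ⟨p, hp, rfl⟩
    have := key x p.2 (hP p hp)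
    rwa [← (hP p hp).length_eq] at this)
  simpa using this

end SwapBribery

/-! ### Kendall tau distance and swaps -/

namespace SwapBribery

open Finset

namespace Ranking

variable {m : ℕ}

/-- The ordered pairs of candidates whose order in `R` disagrees with their order in `X`. -/
def inverted (X R : Ranking m) : Finset (Fin m × Fin m) :=
  {p | pos X p.1 < pos X p.2 ∧ pos R p.2 < pos R p.1}

@[simp] theorem mem_inverted {X R : Ranking m} {x y : Fin m} :
    (x, y) ∈ inverted X R ↔ pos X x < pos X y ∧ pos R y < pos R x := by
  simp [inverted]

/-- Each unordered pair in disagreement has exactly one orientation that follows `X`. -/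
theorem kendallTau_eq_card_inverted (X R : Ranking m) : kendallTau X R = #(inverted X R) := by
  have h : disagreements X R =
      (fun p : Fin m × Fin m => ({p.1, p.2} : Finset (Fin m))) '' (inverted X R : Set _) := by
    ext s
    constructor
    · rintro ⟨x, y, rfl, h | h⟩
      · exact ⟨(x, y), by simpa [Before] using h, rfl⟩
      · exact ⟨(y, x), by simpa [Before] using h, pair_comm y x⟩
    · rintro ⟨⟨x, y⟩, h, rfl⟩
      exact ⟨x, y, rfl, .inl (by simpa [Before] using h)⟩
  rw [kendallTau, h, Set.InjOn.ncard_image, Set.ncard_coe_finset]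
  rintro ⟨a, b⟩ hab ⟨c, d⟩ hcd h
  simp only [mem_coe, mem_inverted] at hab hcd
  have h' : s(a, b) = s(c, d) := by
    have := congrArg (fun s : Finset (Fin m) => (s : Set (Fin m))) h
    simp only [coe_pair] at this
    rw [Set.pair_eq_pair_iff] at this
    exact Sym2.eq_iff.2 this
  rcases Sym2.eq_iff.1 h' with ⟨rfl, rfl⟩ | ⟨rfl, rfl⟩
  · rfl
  · exact absurd hab.1 hcd.1.asymm

theorem pos_injective (R : Ranking m) : Function.Injective (pos R) := R.symm.injective

theorem pos_swap (R : Ranking m) (c c' z : Fin m) :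
    pos (R.trans (Equiv.swap c c')) z = pos R (Equiv.swap c c' z) := rfl

/-- An admissible swap changes the order of just one pair. -/
theorem pos_swap_lt_iff {R : Ranking m} {c c' x y : Fin m}
    (hc : (pos R c' : ℕ) = (pos R c : ℕ) + 1) (h : ¬ (x = c ∧ y = c')) (h' : ¬ (x = c' ∧ y = c)) :
    pos (R.trans (Equiv.swap c c')) x < pos (R.trans (Equiv.swap c c')) y ↔ pos R x < pos R y := by
  have ne : ∀ {a b : Fin m}, a ≠ b → (pos R a : ℕ) ≠ pos R b := fun hab h =>
    hab (pos_injective R (Fin.ext h))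
  rw [pos_swap, pos_swap, Fin.lt_def, Fin.lt_def]
  by_cases hx : x = c
  · subst hx
    have hy : y ≠ c' := fun hy => h ⟨rfl, hy⟩
    by_cases hy' : y = x
    · simp [hy']
    · rw [Equiv.swap_apply_left, Equiv.swap_apply_of_ne_of_ne hy' hy]
      have := ne hy
      have := ne hy'
      omega
  by_cases hx' : x = c'
  · subst hx'
    have hy : y ≠ c := fun hy => h' ⟨rfl, hy⟩
    by_cases hy' : y = x
    · simp [hy']
    · rw [Equiv.swap_apply_right, Equiv.swap_apply_of_ne_of_ne hy hy']
      have := ne hy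
      have := ne hy'
      omega
  rw [Equiv.swap_apply_of_ne_of_ne hx hx']
  have := ne hx
  have := ne hx'
  by_cases hy : y = c
  · subst hy
    rw [Equiv.swap_apply_left]
    omega
  by_cases hy' : y = c'
  · subst hy'
    rw [Equiv.swap_apply_right]
    omega
  rw [Equiv.swap_apply_of_ne_of_ne hy hy']

/-- Every pair inverted before the swap is still inverted afterwards, except possibly the swapped
pair, taken in the orientation given by `X`. -/
theorem kendallTau_le_of_admissibleSwap (X : Ranking m) {R S : Ranking m}
    (h : AdmissibleSwap R S) : kendallTau X R ≤ kendallTau X S + 1 := by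
  obtain ⟨c, c', hc, rfl⟩ := h
  rw [kendallTau_eq_card_inverted, kendallTau_eq_card_inverted]
  refine (card_le_card ?_).trans (card_insert_le
    (if pos X c < pos X c' then (c, c') else (c', c)) _)
  rintro ⟨x, y⟩ h
  rw [mem_inverted] at h
  rw [mem_insert, mem_inverted]
  by_cases h₁ : y = c ∧ x = c'
  · obtain ⟨rfl, rfl⟩ := h₁
    exact .inl (by rw [if_neg h.1.asymm])
  by_cases h₂ : y = c' ∧ x = c
  · obtain ⟨rfl, rfl⟩ := h₂
    exact .inl (by rw [if_pos h.1])
  exact .inr ⟨h.1, (pos_swap_lt_iff hc h₁ h₂).2 h.2⟩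

theorem kendallTau_le_of_swapsTo (X : Ranking m) {l : ℕ} {R S : Ranking m}
    (h : SwapsTo l R S) : kendallTau X R ≤ kendallTau X S + l := by
  induction h with
  | refl R => simp
  | step _ h ih =>
    have := kendallTau_le_of_admissibleSwap X h
    omega

/-- Otherwise the position in `X` increases at each step down `R`, hence is strictly monotone along
`R`, and nothing is inverted. -/
theorem exists_adjacent_inverted (X R : Ranking m) (h : kendallTau X R ≠ 0) :
    ∃ c c' : Fin m, (pos R c' : ℕ) = (pos R c : ℕ) + 1 ∧ pos X c' < pos X c := by
  by_contra! hR
  apply h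
  rw [kendallTau_eq_card_inverted, card_eq_zero, eq_empty_iff_forall_notMem]
  rintro ⟨x, y⟩ hxy
  rw [mem_inverted] at hxy
  cases m with
  | zero => exact x.elim0
  | succ m =>
    have mono : StrictMono fun i => pos X (R i) := by
      refine Fin.strictMono_iff_lt_succ.2 fun i => lt_of_le_of_ne
        (hR (R i.castSucc) (R i.succ) (by simp [pos])) fun he => ?_
      have := R.injective (pos_injective X he)
      exact absurd this (Fin.castSucc_lt_succ).ne
    have := mono hxy.2
    simp only [pos, Equiv.apply_symm_apply] at this hxy
    exact absurd this hxy.1.asymm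

theorem exists_admissibleSwap (X R : Ranking m) (h : kendallTau X R ≠ 0) :
    ∃ S, AdmissibleSwap R S ∧ kendallTau X S + 1 ≤ kendallTau X R := by
  obtain ⟨c, c', hc, hX⟩ := exists_adjacent_inverted X R h
  refine ⟨_, ⟨c, c', hc, rfl⟩, ?_⟩
  rw [kendallTau_eq_card_inverted, kendallTau_eq_card_inverted]
  have hmem : (c', c) ∈ inverted X R := by
    rw [mem_inverted, Fin.lt_def (a := pos R c)]
    exact ⟨hX, by omega⟩
  rw [← card_erase_add_one hmem]
  refine Nat.succ_le_succ (card_le_card ?_)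
  rintro ⟨x, y⟩ h
  rw [mem_inverted] at h
  rw [mem_erase, mem_inverted]
  by_cases h₁ : y = c ∧ x = c'
  · obtain ⟨rfl, rfl⟩ := h₁
    have := h.2
    rw [pos_swap, pos_swap, Equiv.swap_apply_left, Equiv.swap_apply_right, Fin.lt_def] at this
    omega
  by_cases h₂ : y = c' ∧ x = c
  · obtain ⟨rfl, rfl⟩ := h₂
    exact absurd h.1 hX.asymm
  refine ⟨fun he => h₁ ?_, h.1, (pos_swap_lt_iff hc h₁ h₂).1 h.2⟩
  rw [Prod.mk.injEq] at he
  exact he.symm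

theorem exists_swapsTo (X R : Ranking m) (l : ℕ) (hl : l ≤ kendallTau X R) :
    ∃ S, SwapsTo l R S ∧ kendallTau X S + l ≤ kendallTau X R := by
  induction l with
  | zero => exact ⟨R, .refl R, le_rfl⟩
  | succ l ih =>
    obtain ⟨S, hS, hX⟩ := ih (by omega)
    -- Fewer swaps than the initial distance cannot have brought it to zero, so a further useful
    -- swap exists.
    have := kendallTau_le_of_swapsTo X hS
    obtain ⟨T, hT, hXT⟩ := exists_admissibleSwap X S (by omega)
    exact ⟨T, hS.step hT, by omega⟩

end Ranking

/-! ### The cheapest choice of swaps -/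

section Knapsack

variable {ι : Type*} [Fintype ι]

/-- A discrete intermediate value argument: while the sum is too small, some coordinate is below its
bound and can be raised by one. -/
theorem exists_le_sum_eq (d : ι → ℕ) (n : ℕ) (hn : n ≤ ∑ i, d i) :
    ∃ r : ι → ℕ, (∀ i, r i ≤ d i) ∧ ∑ i, r i = n := by
  classical
  induction n with
  | zero => exact ⟨0, by simp, by simp⟩
  | succ n ih =>
    obtain ⟨r, hr, hs⟩ := ih (by omega)
    obtain ⟨i, -, hi⟩ := exists_lt_of_sum_lt (s := univ) (f := r) (g := d) (by omega)
    refine ⟨Function.update r i (r i + 1), fun j => ?_, ?_⟩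
    · by_cases h : j = i
      · subst h; simpa using hi
      · simpa [h] using hr j
    · rw [sum_update_of_mem (mem_univ i), ← hs, ← sum_sdiff (subset_univ {i})]
      simp
      ring

/-- Up to `d i` units of cost `c i` can be bought for each `i`. One can buy all but at most `k` of
the units within the budget `b` if and only if this is affordable according to each unit's cost. -/
theorem exists_affordable_iff (d c : ι → ℕ) (b k : ℕ) :
    (∃ r : ι → ℕ, (∀ i, r i ≤ d i) ∧ ∑ i, r i * c i ≤ b ∧ ∑ i, (d i - r i) ≤ k) ↔
      ∀ j, d j ≠ 0 → ∑ i, d i * min (c i) (c j) ≤ b + k * c j := by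
  constructor
  · rintro ⟨r, hr, hb, hk⟩ j -
    -- A bought unit is estimated by its own price, an omitted one by `c j`.
    calc ∑ i, d i * min (c i) (c j) ≤ ∑ i, (r i * c i + (d i - r i) * c j) := by
          refine sum_le_sum fun i _ => ?_
          calc d i * min (c i) (c j) = (r i + (d i - r i)) * min (c i) (c j) := by
                rw [Nat.add_sub_cancel' (hr i)]
            _ = r i * min (c i) (c j) + (d i - r i) * min (c i) (c j) := Nat.add_mul _ _ _
            _ ≤ _ := add_le_add (Nat.mul_le_mul_left _ (min_le_left _ _))
                (Nat.mul_le_mul_left _ (min_le_right _ _))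
      _ = ∑ i, r i * c i + (∑ i, (d i - r i)) * c j := by rw [sum_add_distrib, sum_mul]
      _ ≤ b + k * c j := add_le_add hb (Nat.mul_le_mul_right _ hk)
  · intro h
    by_cases hk : ∑ i, d i ≤ k
    · exact ⟨0, by simp, by simp, by simpa using hk⟩
    rw [not_le] at hk
    -- The number of units cheaper than `t`.
    let u : ℕ → ℕ := fun t => ∑ i, if c i < t then d i else 0
    have hu : ∃ t, ∑ i, d i - k ≤ u t := by
      refine ⟨∑ i, c i + 1, (Nat.sub_le _ _).trans (sum_le_sum fun i _ => ?_)⟩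
      rw [if_pos (Nat.lt_succ_of_le (single_le_sum (fun _ _ => Nat.zero_le _) (mem_univ i)))]
    -- The threshold `t` is the price of the last unit that a greedy buyer takes: the units below
    -- `t` are too few, those up to `t` suffice. The threshold is not zero-indexed away, because no
    -- unit is cheaper than `0`.
    obtain ⟨t, ht, htu⟩ : ∃ t, u t < ∑ i, d i - k ∧ ∑ i, d i - k ≤ u (t + 1) := by
      classical
      have hspec := Nat.find_spec hu
      have hmin := fun s => Nat.find_min hu (m := s)
      generalize Nat.find hu = s at hspec hmin
      cases s with
      | zero => simp [u] at hspec; omega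
      | succ s => exact ⟨s, not_le.1 (hmin s (Nat.lt_succ_self s)), hspec⟩
    let e : ι → ℕ := fun i => if c i = t then d i else 0
    have hue : u (t + 1) = u t + ∑ i, e i := by
      rw [← sum_add_distrib]
      refine sum_congr rfl fun i _ => ?_
      simp only [e]
      split_ifs <;> omega
    -- All units cheaper than `t` are bought, and `q` chooses among those of price exactly `t` to
    -- reach the required number. Some are still missing, so the price `t` does occur and the
    -- hypothesis applies to it.
    obtain ⟨q, hq, hqs⟩ := exists_le_sum_eq e (∑ i, d i - k - u t) (by omega)
    obtain ⟨j, -, hj⟩ : ∃ j ∈ univ, e j ≠ 0 := exists_ne_zero_of_sum_ne_zero (by omega)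
    have hjt : c j = t := by
      by_contra hne
      exact hj (if_neg hne)
    have hdj : d j ≠ 0 := by simpa [e, hjt] using hj
    let r : ι → ℕ := fun i => (if c i < t then d i else 0) + q i
    have hr : ∀ i, r i ≤ d i := fun i => by
      have := hq i
      simp only [r, e] at this ⊢
      split_ifs at this ⊢ <;> omega
    have hrs : ∑ i, r i = ∑ i, d i - k := by
      simp only [r, sum_add_distrib, hqs]
      change u t + _ = _
      omega
    have hrd : ∑ i, (d i - r i) = k := by
      rw [sum_tsub_distrib _ fun i _ => hr i, hrs]
      omega
    refine ⟨r, hr, ?_, hrd.le⟩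
    -- Equality holds in the estimate of the other direction, since bought units cost at most `t`
    -- and omitted ones at least `t`.
    have key : ∑ i, d i * min (c i) (c j) = ∑ i, r i * c i + k * c j := by
      rw [← hrd, sum_mul, ← sum_add_distrib]
      refine sum_congr rfl fun i _ => ?_
      have hqi := hq i
      rw [hjt]
      rcases lt_trichotomy (c i) t with h | h | h
      · have : q i = 0 := by simpa [e, h.ne] using hqi
        simp [r, h, this, min_eq_left h.le]
      · have : r i = q i := by simp [r, h]
        rw [h, min_self, ← Nat.add_mul, Nat.add_sub_cancel' (hr i)]
      · have h₁ : q i = 0 := by simpa [e, h.ne'] using hqi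
        have h₂ : r i = 0 := by simp [r, h₁, h.not_gt]
        simp [h₂, min_eq_right h.le]
    have := h j hdj
    omega

end Knapsack

theorem Instance.isYes_iff (I : Instance) :
    I.IsYes ↔ 0 ≤ I.k ∧ ∀ j, Ranking.kendallTau I.X (I.R j) ≠ 0 →
      ∑ i, Ranking.kendallTau I.X (I.R i) * min (I.cost i) (I.cost j) ≤
        I.bgt + I.k.natAbs * I.cost j := by
  rw [← exists_affordable_iff]
  constructor
  · rintro ⟨R', l, hl, hb, hk⟩
    -- Swaps beyond the initial distance are cut off: this only saves money, and the distance could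
    -- not fall below zero anyway.
    refine ⟨(Int.natCast_nonneg _).trans hk,
      fun i => min (l i) (Ranking.kendallTau I.X (I.R i)), fun i => min_le_right _ _,
      (sum_le_sum fun i _ => Nat.mul_le_mul_right _ (min_le_left _ _)).trans hb, ?_⟩
    have : ∑ i, Ranking.kendallTau I.X (R' i) ≤ I.k.natAbs := by omega
    refine (sum_le_sum fun i _ => ?_).trans this
    have := Ranking.kendallTau_le_of_swapsTo I.X (hl i)
    dsimp only
    omega
  · rintro ⟨hk, r, hr, hb, hrk⟩
    choose R' hR' hX using fun i => Ranking.exists_swapsTo I.X (I.R i) (r i) (hr i)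
    refine ⟨R', r, hR', hb, ?_⟩
    have : ∑ i, Ranking.kendallTau I.X (R' i) ≤ I.k.natAbs := by
      refine (sum_le_sum fun i _ => ?_).trans hrk
      have := hX i
      omega
    omega

/-! ### Inversions of lists -/

section Inversions

theorem idxOf_erase_lt_iff (r : List ℕ) {a b c : ℕ} (hb : b ≠ a) (hc : c ≠ a) :
    (r.erase a).idxOf b < (r.erase a).idxOf c ↔ r.idxOf b < r.idxOf c := by
  induction r with
  | nil => simp
  | cons d r ih =>
    by_cases hd : d = a
    · subst hd
      simp [List.idxOf_cons_ne _ hb.symm, List.idxOf_cons_ne _ hc.symm]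
    · rw [List.erase_cons_tail (by simpa using hd)]
      by_cases hdb : d = b <;> by_cases hdc : d = c
      · simp [← hdb, ← hdc]
      · subst hdb; simp [List.idxOf_cons_ne _ hdc]
      · subst hdc; simp
      · simp [List.idxOf_cons_ne _ hdb, List.idxOf_cons_ne _ hdc, ih]

/-- Reads a position as a number of predecessors, which turns the sum in `inversions` into a count
of pairs. -/
theorem card_idxOf_lt (r : List ℕ) (hr : r.Nodup) (a : ℕ) (ha : a ∈ r) :
    #{c ∈ r.toFinset | r.idxOf c < r.idxOf a} = r.idxOf a := by
  induction r with
  | nil => simp at ha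
  | cons d r ih =>
    rw [List.nodup_cons] at hr
    by_cases hd : d = a
    · subst hd
      simp
    · have ha' : a ∈ r := by simpa [Ne.symm hd] using ha
      have key : {c ∈ r.toFinset | (d :: r).idxOf c < r.idxOf a + 1} =
          {c ∈ r.toFinset | r.idxOf c < r.idxOf a} := by
        refine filter_congr fun c hc => ?_
        have : d ≠ c := by
          rintro rfl
          exact hr.1 (by simpa using hc)
        rw [List.idxOf_cons_ne _ this]
        omega
      rw [List.idxOf_cons_ne _ hd, List.toFinset_cons, filter_insert, if_pos (by simp),
        card_insert_of_notMem (by simp [hr.1]), Nat.succ_eq_add_one, key, ih hr.2 ha']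

/-- The inverted pairs are split by their first entry. The head `a` precedes all others in `x`, so
its pairs are given by its predecessors in `r`; the other pairs lie in the tail, and erasing `a`
does not affect their order. -/
theorem inversions_eq_card (x r : List ℕ) (hx : x.Nodup) (h : x.Perm r) :
    inversions x r = #{p ∈ x.toFinset ×ˢ x.toFinset |
      x.idxOf p.1 < x.idxOf p.2 ∧ r.idxOf p.2 < r.idxOf p.1} := by
  induction x generalizing r with
  | nil => simp [inversions]
  | cons a x ih =>
    have hr := h.nodup hx
    rw [List.nodup_cons] at hx
    have ha : a ∈ r := h.subset (by simp)
    rw [inversions, ih _ hx.2 (List.cons_perm_iff_perm_erase.1 h).2, ← card_idxOf_lt r hr a ha]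
    have hne : ∀ {b}, b ∈ x → a ≠ b := by
      rintro b hb rfl
      exact hx.1 hb
    rw [← card_image_of_injective (s := {c ∈ r.toFinset | r.idxOf c < r.idxOf a})
      (f := fun c => (a, c)) (fun c c' h => (Prod.mk.injEq _ _ _ _ ▸ h).2),
      ← card_union_of_disjoint]
    · congr 1
      ext ⟨b, c⟩
      simp only [mem_union, mem_image, mem_filter, List.mem_toFinset, mem_product,
        Prod.mk.injEq, List.mem_cons]
      constructor
      · rintro (⟨c, ⟨hc, hlt⟩, rfl, rfl⟩ | ⟨⟨hb, hc⟩, h₁, h₂⟩)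
        · have hca : c ≠ a := by rintro rfl; exact absurd hlt (lt_irrefl _)
          refine ⟨⟨.inl rfl, List.mem_cons.1 (h.symm.subset hc)⟩, ?_, hlt⟩
          rw [List.idxOf_cons_self, List.idxOf_cons_ne _ hca.symm]
          omega
        · rw [List.idxOf_cons_ne _ (hne hb), List.idxOf_cons_ne _ (hne hc)]
          exact ⟨⟨.inr hb, .inr hc⟩, by omega,
            (idxOf_erase_lt_iff r (hne hc).symm (hne hb).symm).1 h₂⟩
      · rintro ⟨⟨hb, hc⟩, h₁, h₂⟩
        have hac : a ≠ c := by
          rintro rfl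
          simp at h₁
        have hc : c ∈ x := by
          rcases hc with rfl | hc
          exacts [absurd rfl hac, hc]
        rcases hb with rfl | hb
        · exact .inl ⟨c, ⟨h.subset (by simp [hc]), h₂⟩, rfl, rfl⟩
        · rw [List.idxOf_cons_ne _ (hne hb), List.idxOf_cons_ne _ hac] at h₁
          exact .inr ⟨⟨hb, hc⟩, by omega,
            (idxOf_erase_lt_iff r hac.symm (hne hb).symm).2 h₂⟩
    · rw [disjoint_left]
      rintro ⟨b, c⟩ h₁ h₂
      simp only [mem_image, mem_filter, List.mem_toFinset, mem_product, Prod.mk.injEq] at h₁ h₂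
      obtain ⟨-, -, rfl, -⟩ := h₁
      exact hx.1 h₂.1.1

end Inversions

/-- The candidates of a ranking from top to bottom. -/
def Ranking.toList {m : ℕ} (π : Ranking m) : List ℕ := (List.finRange m).map fun i => (π i : ℕ)

/-! ### Rankings as lists of numbers. -/

namespace Ranking

variable {m : ℕ}

theorem nodup_toList (π : Ranking m) : π.toList.Nodup :=
  (List.nodup_finRange m).map (Fin.val_injective.comp π.injective)

theorem mem_toList {π : Ranking m} {a : ℕ} : a ∈ π.toList ↔ a < m := by
  simp only [toList, List.mem_map, List.mem_finRange, true_and]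
  constructor
  · rintro ⟨i, rfl⟩
    exact (π i).2
  · intro h
    exact ⟨π.symm ⟨a, h⟩, by simp⟩

theorem perm_toList (π π' : Ranking m) : π.toList.Perm π'.toList :=
  (List.perm_ext_iff_of_nodup π.nodup_toList π'.nodup_toList).2 fun _ => by
    rw [mem_toList, mem_toList]

@[simp] theorem length_toList (π : Ranking m) : π.toList.length = m := by simp [toList]

theorem idxOf_toList (π : Ranking m) (c : Fin m) : π.toList.idxOf (c : ℕ) = pos π c := by
  have h : (pos π c : ℕ) < π.toList.length := by simp
  have := π.nodup_toList.idxOf_getElem _ h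
  rwa [show π.toList[(pos π c : ℕ)] = (c : ℕ) by simp [toList, pos]] at this

theorem inversions_toList (X R : Ranking m) :
    inversions X.toList R.toList = kendallTau X R := by
  rw [inversions_eq_card _ _ X.nodup_toList (X.perm_toList R), kendallTau_eq_card_inverted]
  symm
  refine card_bij (fun p _ => ((p.1 : ℕ), (p.2 : ℕ))) ?_ ?_ ?_
  · rintro ⟨x, y⟩ h
    rw [mem_inverted] at h
    simpa [idxOf_toList, mem_toList] using h
  · rintro ⟨x, y⟩ - ⟨x', y'⟩ - h
    simpa [Fin.val_inj] using h
  · rintro ⟨x, y⟩ h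
    simp only [mem_filter, mem_product, List.mem_toFinset, mem_toList] at h
    obtain ⟨⟨hx, hy⟩, h⟩ := h
    refine ⟨(⟨x, hx⟩, ⟨y, hy⟩), ?_, rfl⟩
    have h₁ := idxOf_toList X ⟨x, hx⟩
    have h₂ := idxOf_toList X ⟨y, hy⟩
    have h₃ := idxOf_toList R ⟨x, hx⟩
    have h₄ := idxOf_toList R ⟨y, hy⟩
    simp only at h₁ h₂ h₃ h₄
    rw [mem_inverted, Fin.lt_def, Fin.lt_def, ← h₁, ← h₂, ← h₃, ← h₄]
    exact h

end Ranking

end SwapBribery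

/-! ### The main theorem -/

namespace SwapBribery

open Computability StackProgram

/-- Every candidate and every voter takes up at least one letter, so their numbers are bounded by
the input length. -/
theorem length_le_length_flatMap {α : Type} (g : α → List Letter) (hg : ∀ a, g a ≠ [])
    (l : List α) : l.length ≤ (l.flatMap g).length := by
  induction l with
  | nil => simp
  | cons a l ih =>
    have := List.length_pos_iff.2 (hg a)
    simp only [List.flatMap_cons, List.length_append, List.length_cons]
    omega

theorem length_le_length_flatMap_of_mem {α : Type} (g : α → List Letter) {l : List α} {a : α}
    (h : a ∈ l) : (g a).length ≤ (l.flatMap g).length := by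
  obtain ⟨l₁, l₂, rfl⟩ := List.append_of_mem h
  simp only [List.flatMap_append, List.flatMap_cons, List.length_append]
  omega

theorem encodeNumber_ne_nil (a : ℕ) : encodeNumber a ≠ [] := by simp [encodeNumber]

theorem length_encodeNat_lt (a : ℕ) : (encodeNat a).length < (encodeNumber a).length := by
  simp [encodeNumber]

theorem encodeRanking_eq {m : ℕ} (π : Ranking m) :
    encodeRanking π = encodeRankingList π.toList := by
  simp [encodeRanking, encodeRankingList, Ranking.toList, encodeNumbers, List.flatMap_map]

/-! ### The program on encoded instances. -/

namespace Instance

/-- The costs and the rankings of the voters. -/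
def voters (I : Instance) : List (ℕ × List ℕ) :=
  (List.finRange I.n).map fun i => (I.cost i, (I.R i).toList)

theorem perm_of_mem_voters (I : Instance) : ∀ p ∈ I.voters, I.X.toList.Perm p.2 := by
  simp only [voters, List.mem_map]
  rintro _ ⟨i, -, rfl⟩
  exact I.X.perm_toList (I.R i)

theorem encode_eq (I : Instance) :
    encodeInstance I = encodeNumber I.bgt ++ .bit (decide (I.k < 0)) :: encodeNumber I.k.natAbs ++
      encodeRankingList I.X.toList ++ I.voters.flatMap encodeVoter := by
  simp [encodeInstance, encodeInteger, voters, encodeRanking_eq, List.flatMap_map, encodeVoter]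

/-- The costs of the single swaps that could be useful. -/
def units (I : Instance) : List ℕ := unitCosts I.X.toList I.voters

theorem mem_units {I : Instance} {a : ℕ} :
    a ∈ I.units ↔ ∃ j, Ranking.kendallTau I.X (I.R j) ≠ 0 ∧ I.cost j = a := by
  simp only [units, unitCosts, voters, List.mem_flatMap, List.mem_reverse, List.mem_map,
    List.mem_finRange, true_and, List.mem_replicate]
  constructor
  · rintro ⟨_, ⟨j, rfl⟩, h, rfl⟩
    exact ⟨j, by rwa [Ranking.inversions_toList] at h, rfl⟩
  · rintro ⟨j, h, rfl⟩
    exact ⟨_, ⟨j, rfl⟩, by rwa [Ranking.inversions_toList], rfl⟩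

/-- Identifies the sums over the explicit list, which the program computes, with the weighted sums
in `isYes_iff`. -/
theorem sum_map_units (I : Instance) (g : ℕ → ℕ) :
    (I.units.map g).sum = ∑ i, Ranking.kendallTau I.X (I.R i) * g (I.cost i) := by
  simp [units, unitCosts, voters, List.flatMap_def, List.sum_flatten,
    List.sum_reverse, Function.comp_def, Ranking.inversions_toList, Fin.sum_univ_def]

theorem answer_eq (I : Instance) :
    answer I = (!decide (I.k < 0) &&
      decide (∀ a ∈ I.units, Affordable I.bgt I.k.natAbs I.units a)) := by
  have h : I.IsYes ↔ ¬ I.k < 0 ∧ ∀ a ∈ I.units, Affordable I.bgt I.k.natAbs I.units a := by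
    rw [I.isYes_iff, not_lt]
    refine and_congr_right fun _ => ?_
    simp only [mem_units, Affordable, I.sum_map_units]
    constructor
    · rintro h _ ⟨j, hj, rfl⟩
      exact h j hj
    · exact fun h j hj => h _ ⟨j, hj, rfl⟩
  classical
  rw [answer, ← decide_not, ← Bool.decide_and]
  exact decide_eq_decide.2 h

theorem runs_decideBribery (I : Instance) :
    Runs decideBribery (Function.update (fun _ => []) .inp (encodeInstance I))
      (Function.update (fun _ => []) .ok [.bit (answer I)])
      (stepBound (encodeInstance I).length (encodeInstance I).length (encodeInstance I).length
        ((encodeInstance I).length * ((encodeInstance I).length * (encodeInstance I).length))) := by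
  have hlen := congrArg List.length I.encode_eq
  simp only [encodeRankingList, List.length_append, List.length_cons] at hlen
  have hb := length_encodeNat_lt I.bgt
  have hn := length_encodeNat_lt I.k.natAbs
  have hm : I.X.toList.length ≤ (encodeInstance I).length :=
    (length_le_length_flatMap encodeNumber encodeNumber_ne_nil I.X.toList).trans
      (by unfold encodeNumbers at hlen; omega)
  have hp : I.voters.length ≤ (encodeInstance I).length :=
    (length_le_length_flatMap encodeVoter (fun p => by simp [encodeVoter, encodeNumber])
      I.voters).trans (by omega)
  have hx : ∀ c ∈ I.X.toList, (encodeNat c).length ≤ (encodeInstance I).length := fun c hc => by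
    have h₁ := length_le_length_flatMap_of_mem encodeNumber hc
    have h₂ := length_encodeNat_lt c
    unfold encodeNumbers at hlen
    omega
  have hc : ∀ p ∈ I.voters, (encodeNat p.1).length ≤ (encodeInstance I).length := fun p hp => by
    have h₁ := length_le_length_flatMap_of_mem encodeVoter hp
    have h₂ := length_encodeNat_lt p.1
    simp only [encodeVoter, List.length_append] at h₁ hlen
    omega
  have hU := length_unitCosts_le I.X.toList I.voters I.perm_of_mem_voters
  have := SwapBribery.runs_decideBribery I.bgt I.k.natAbs (decide (I.k < 0)) I.X.toList I.voters
    (N := (encodeInstance I).length) (by omega) (by omega) hx I.perm_of_mem_voters hc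
  rw [← I.encode_eq, ← units, ← I.answer_eq] at this
  -- Digits, candidates and voters are each bounded by the input length, and the useful swaps by its
  -- cube.
  exact this.mono (stepBound_mono le_rfl hm hp (hU.trans (by gcongr)))

end Instance

/-- The step bound of the machine. -/
noncomputable def timePolynomial : Polynomial ℕ :=
  stepBound Polynomial.X Polynomial.X Polynomial.X
    (Polynomial.X * (Polynomial.X * Polynomial.X)) + 1

/-- As `stepBound` makes sense in every commutative semiring, the same expression serves as a number
and as a polynomial. The summand `1` is the machine's final output step. -/
theorem eval_timePolynomial (N : ℕ) :
    timePolynomial.eval N = stepBound N N N (N * (N * N)) + 1 := by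
  simp [timePolynomial, stepBound]

end SwapBribery

theorem mainTheorem4 :
    Nonempty (Turing.TM2ComputableInPolyTime SwapBribery.encodeInstance
      Computability.encodeBool SwapBribery.answer) :=
  ⟨SwapBribery.decideBribery.computableInPolyTime .inp .ok SwapBribery.digit
    SwapBribery.timePolynomial (fun _ => rfl) fun I =>
      ⟨_, _, rfl, (SwapBribery.eval_timePolynomial _).ge, I.runs_decideBribery⟩⟩
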